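/- Let $D\in\mathbb R^{m\times m}$ be in real canonical form: block diagonal, each block being either a Jordan cell (upper triangular, $\lambda$ on the diagonal and $1$ on the superdiagonal) of a real eigenvalue $\lambda$, or a cell with $2\times2$ blocks $\begin{pmatrix}a&-b\\ b&a\end{pmatrix}$, $b\ne0$, on the block diagonal and $I_2$ on the block superdiagonal. Let $\lambda_j$ be the real part of the eigenvalue belonging to the block that contains coordinate $j$, and assume $0<\lambda_j<1$ for $j=1,\dots,m$. Then there are integers $1\le p_j\le m$ $(j=1,\dots,m)$, depending only on $D,d,m$, such that the following holds. Let $E\in\mathbb R^{d\times d}$ be a matrix all of whose complex eigenvalues have real part $>1$, put $q=\operatorname{trace}E$ and $c^{A}=\exp((\log c)A)$, let $\|\cdot\|$ be a norm on $\mathbb R^d$, put $\|x\|_E=\int_0^1\|t^Ex\|\,\frac{dt}t$, and let $\tau_E$ be the radial part with respect to $E$: $\tau_E(0)=0$, and for $x\neq0$, $\tau_E(x)$ is the unique $t>0$ with $\|t^{-E}x\|_E=1$. Let $X=\{X(x):x\in\mathbb R^d\}$ be one of the following $\mathbb R^m$-valued Gaussian random fields: (a) the moving average field $X_\phi(x)=\int_{\mathbb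 R^d}\big[\phi(x-y)^{D-\frac q2I_m}-\phi(-y)^{D-\frac q2I_m}\big]M_2(dy)$, where $M_2$ is an $\mathbb R^m$-valued symmetric Gaussian random measure with Lebesgue control measure (that is, $\mathbb E\,e^{i\langle\theta,M_2(A)\rangle}=e^{-|A|\|\theta\|_2^2}$, where $\|\cdot\|_2$ is the Euclidean norm), $\phi:\mathbb R^d\to[0,\infty)$ is $E$-homogeneous ($\phi(c^Ex)=c\,\phi(x)$ for $c>0$, $x\ne0$) and $(\beta,E)$-admissible with $\beta>0$ ($\phi(x)>0$ for $x\neq 0$, and for all $0<A<B$ there is $C>0$ such that $|\phi(x+y)-\phi(y)|\le C\,\tau_E(x)^\beta$ whenever $A\le\|y\|\le B$ and $\tau_E(x)\le1$), $\lambda_j<\beta$ for all $j$, and $\frac q2$ is not an eigenvalue of $D$; (b) the harmonizable field $X_\psi(x)=\operatorname{Re}\int_{\mathbb R^d}(e^{i\langle x,y\rangle}-1)\,\psi(y)^{-D-\frac q2I_m}\,W_2(dy)$, where $W_2$ is a $\mathbb C^m$-valued symmetric (isotropic) Gaussian random measure with Lebesgue control measure (that is, $\mathbb E\,e^{i\operatorname{Re}\langle\theta,W_2(A)\rangle}=e^{-|A|\|\theta\|_2^2}$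 for $\theta\in\mathbb C^m$), and $\psi:\mathbb R^d\to[0,\infty)$ is continuous, $E^{*}$-homogeneous, and nonzero off the origin. Then $X$ has a modification whose sample paths are almost surely continuous on $[0,1]^d$, and there is a constant $0<C<\infty$, which does not depend on $\omega$ but only on the data $(d,m,E,D,\|\cdot\|,\phi$ or $\psi)$ of the field, such that for every such modification (again denoted $X$) and every $j=1,\dots,m$, almost surely $$\limsup_{r\downarrow0}\ \sup_{\substack{x,y\in[0,1]^d,\ x\ne y\\ \tau_E(x-y)\le r}}\frac{|X_j(x)-X_j(y)|}{\tau_E(x-y)^{\lambda_j}\big[\log\big(1/\tau_E(x-y)\big)\big]^{p_j-\frac12}}\le C .$$ Moreover, for every $\varepsilon>0$, almost surely there is a finite (random) constant $K>0$ such that for every $j=1,\dots,m$ $$|X_j(x)-X_j(y)|\le K\,\tau_E(x-y)^{\lambda_j-\varepsilon}\qquad\text{for all }x,y\in[0,1]^d .$$ -/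

import Mathlib

open MeasureTheory ProbabilityTheory Filter Topology Matrix
open scoped ENNReal

noncomputable section

namespace OSS

/-- The matrix power `c ^ A = exp (log c • A)`, for `c > 0`. -/
def matPow {n : ℕ} (c : ℝ) (A : Matrix (Fin n) (Fin n) ℝ) : Matrix (Fin n) (Fin n) ℝ :=
  NormedSpace.exp (Real.log c • A)

/-! ### Real canonical form -/

/-- The cells of a real canonical form: `real n a` is the `n × n` Jordan cell of the real
eigenvalue `a`; `complex n a b` is the `2n × 2n` cell of the pair `a ± i b`, with `b ≠ 0`. -/
inductive RealCell where
  | real (n : ℕ) (a : ℝ) : RealCell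
  | complex (n : ℕ) (a b : ℝ) (hb : b ≠ 0) : RealCell

/-- The number of rows of a cell. -/
def RealCell.size : RealCell → ℕ
  | .real n _ => n
  | .complex n _ _ _ => 2 * n

/-- The real part of the eigenvalue(s) of a cell. -/
def RealCell.re : RealCell → ℝ
  | .real _ a => a
  | .complex _ a _ _ => a

/-- The cell as a matrix. A real cell has `a` on the diagonal and `1` on the superdiagonal. A
complex cell has the `2 × 2` blocks `!![a, -b; b, a]` on the block diagonal and `2 × 2` identity
matrices on the block superdiagonal. -/
def RealCell.toMatrix : (c : RealCell) → Matrix (Fin c.size) (Fin c.size) ℝ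
  | .real _ a => fun i j =>
      if (i : ℕ) = j then a else if (i : ℕ) + 1 = j then 1 else 0
  | .complex _ a b _ => fun i j =>
      if (i : ℕ) / 2 = (j : ℕ) / 2 then
        (if (i : ℕ) % 2 = (j : ℕ) % 2 then a else if (i : ℕ) % 2 = 0 then -b else b)
      else if (i : ℕ) / 2 + 1 = (j : ℕ) / 2 ∧ (i : ℕ) % 2 = (j : ℕ) % 2 then 1 else 0

/-- `D` is in real canonical form, i.e. it is block diagonal with cells as above (put one after the
other along the diagonal), and `lam j` is the real part of the eigenvalue of the cell that contains
the `j`-th coordinate. -/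
def IsRealCanonicalForm {m : ℕ} (D : Matrix (Fin m) (Fin m) ℝ) (lam : Fin m → ℝ) : Prop :=
  ∃ (k : ℕ) (cell : Fin k → RealCell) (e : (Σₗ i : Fin k, Fin (cell i).size) ≃o Fin m),
    (∀ s t : (Σ i : Fin k, Fin (cell i).size),
      D (e (toLex s)) (e (toLex t)) = Matrix.blockDiagonal' (fun i => (cell i).toMatrix) s t) ∧
    ∀ s : (Σ i : Fin k, Fin (cell i).size), lam (e (toLex s)) = (cell s.1).re

/-! ### Polar coordinates with respect to `E` -/

/-- The norm `‖x‖_E = ∫₀¹ N (t ^ E x) dt / t` attached to a norm `N` on `ℝ^d`. For `x ≠ 0` the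
function `t ↦ ‖t ^ E x‖_E` is strictly increasing on `(0, ∞)`. -/
def polarNorm {d : ℕ} (E : Matrix (Fin d) (Fin d) ℝ) (N : Seminorm ℝ (Fin d → ℝ))
    (x : Fin d → ℝ) : ℝ :=
  ∫ t in (0 : ℝ)..1, N (matPow t E *ᵥ x) / t

/-- The radial part `τ_E(x)`: for `x ≠ 0` it is the unique `t > 0` such that `x = t ^ E θ` with
`‖θ‖_E = 1`, and `τ_E(0) = 0`. As `t ↦ ‖t ^ (-E) x‖_E` decreases strictly from `∞` to `0`, it is
the least `t > 0` with `‖t ^ (-E) x‖_E ≤ 1`; for `x = 0` the infimum is `0`. -/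
def radius {d : ℕ} (E : Matrix (Fin d) (Fin d) ℝ) (N : Seminorm ℝ (Fin d → ℝ))
    (x : Fin d → ℝ) : ℝ :=
  sInf {t : ℝ | 0 < t ∧ polarNorm E N (matPow t (-E) *ᵥ x) ≤ 1}

/-- `f` is `E`-homogeneous. -/
def IsHomogeneous {d : ℕ} (E : Matrix (Fin d) (Fin d) ℝ) (f : (Fin d → ℝ) → ℝ) : Prop :=
  ∀ c : ℝ, 0 < c → ∀ x : Fin d → ℝ, x ≠ 0 → f (matPow c E *ᵥ x) = c * f x

/-- `g` is `(β, E)`-admissible. -/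
def IsAdmissible {d : ℕ} (E : Matrix (Fin d) (Fin d) ℝ) (N : Seminorm ℝ (Fin d → ℝ)) (β : ℝ)
    (g : (Fin d → ℝ) → ℝ) : Prop :=
  (∀ x, 0 ≤ g x) ∧ (∀ x, x ≠ 0 → 0 < g x) ∧
    ∀ A B : ℝ, 0 < A → A < B → ∃ C : ℝ, 0 < C ∧ ∀ y, A ≤ N y → N y ≤ B →
      ∀ x, radius E N x ≤ 1 → |g (x + y) - g y| ≤ C * radius E N x ^ β

/-! ### Gaussian random measures and stochastic integrals -/

section Integral

variable {𝕜 : Type*} [RCLike 𝕜] {Ω : Type*} [MeasurableSpace Ω] {d m : ℕ}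

/-- `M` is a `𝕜^m`-valued symmetric Gaussian random measure on `ℝ^d` with Lebesgue control measure,
`𝕜 = ℝ` or `ℂ`: on Borel sets of finite volume it is independently scattered and (almost surely)
countably additive, and `M(A)` has the characteristic function `θ ↦ exp (-|A| ‖θ‖²)` (where, for
`𝕜 = ℂ`, `ℂ^m` is identified with `ℝ^(2m)`). -/
structure IsGaussianRandomMeasure (P : Measure Ω)
    (M : Set (Fin d → ℝ) → Ω → (Fin m → 𝕜)) : Prop where
  aemeasurable : ∀ A, MeasurableSet A → volume A < ∞ → AEMeasurable (M A) P
  charFun : ∀ A, MeasurableSet A → volume A < ∞ → ∀ θ : Fin m → 𝕜,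
    ∫ ω, Complex.exp (Complex.I * ((RCLike.re (star θ ⬝ᵥ M A ω) : ℝ) : ℂ)) ∂P =
      ((Real.exp (-(volume.real A * ∑ k, ‖θ k‖ ^ 2)) : ℝ) : ℂ)
  indep : ∀ A : ℕ → Set (Fin d → ℝ), (∀ k, MeasurableSet (A k)) → (∀ k, volume (A k) < ∞) →
    Pairwise (Function.onFun Disjoint A) → iIndepFun (fun k => M (A k)) P
  additive : ∀ A : ℕ → Set (Fin d → ℝ), (∀ k, MeasurableSet (A k)) → volume (⋃ k, A k) < ∞ →
    Pairwise (Function.onFun Disjoint A) →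
    ∀ᵐ ω ∂P, Tendsto (fun n => ∑ k ∈ Finset.range n, M (A k) ω) atTop (𝓝 (M (⋃ k, A k) ω))

/-- The integral of a simple matrix-valued function (which vanishes outside a set of finite
volume) against a random measure. -/
def simpleIntegral (M : Set (Fin d → ℝ) → Ω → (Fin m → 𝕜))
    (f : SimpleFunc (Fin d → ℝ) (Matrix (Fin m) (Fin m) 𝕜)) (ω : Ω) : Fin m → 𝕜 :=
  ∑ c ∈ f.range, c *ᵥ M (f ⁻¹' {c}) ω

/-- `Z` is (a version of) the stochastic integral `∫ Q dM`: the limit in probability of the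
integrals of simple functions that converge to `Q` in `L²`. -/
def IsStochasticIntegral (P : Measure Ω) (M : Set (Fin d → ℝ) → Ω → (Fin m → 𝕜))
    (Q : (Fin d → ℝ) → Matrix (Fin m) (Fin m) 𝕜) (Z : Ω → (Fin m → 𝕜)) : Prop :=
  ∃ f : ℕ → SimpleFunc (Fin d → ℝ) (Matrix (Fin m) (Fin m) 𝕜),
    (∀ n, (f n).FinMeasSupp volume) ∧
    Tendsto (fun n => ∫⁻ y, ∑ i, ∑ j, ‖f n y i j - Q y i j‖ₑ ^ 2) atTop (𝓝 0) ∧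
    TendstoInMeasure P (fun n => simpleIntegral M (f n)) atTop Z

end Integral

/-! ### The two random fields -/

/-- The kernel `φ(x - y) ^ (D - (q/2) I) - φ(-y) ^ (D - (q/2) I)`, with `q = trace E`. -/
def movingAverageKernel {d m : ℕ} (E : Matrix (Fin d) (Fin d) ℝ) (D : Matrix (Fin m) (Fin m) ℝ)
    (φ : (Fin d → ℝ) → ℝ) (x y : Fin d → ℝ) : Matrix (Fin m) (Fin m) ℝ :=
  matPow (φ (x - y)) (D - (E.trace / 2) • 1) - matPow (φ (-y)) (D - (E.trace / 2) • 1)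

/-- The kernel `(exp (i ⟨x, y⟩) - 1) ψ(y) ^ (-D - (q/2) I)`, with `q = trace E`. -/
def harmonizableKernel {d m : ℕ} (E : Matrix (Fin d) (Fin d) ℝ) (D : Matrix (Fin m) (Fin m) ℝ)
    (ψ : (Fin d → ℝ) → ℝ) (x y : Fin d → ℝ) : Matrix (Fin m) (Fin m) ℂ :=
  (Complex.exp (Complex.I * ((x ⬝ᵥ y : ℝ) : ℂ)) - 1) •
    (matPow (ψ y) (-D - (E.trace / 2) • 1)).map Complex.ofReal

/-- `X` is the moving average field `X_φ`. -/
def IsMovingAverage {d m : ℕ} {Ω : Type*} [MeasurableSpace Ω] (P : Measure Ω)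
    (E : Matrix (Fin d) (Fin d) ℝ) (D : Matrix (Fin m) (Fin m) ℝ) (φ : (Fin d → ℝ) → ℝ)
    (X : (Fin d → ℝ) → Ω → (Fin m → ℝ)) : Prop :=
  ∃ M : Set (Fin d → ℝ) → Ω → (Fin m → ℝ), IsGaussianRandomMeasure P M ∧
    ∀ x, IsStochasticIntegral P M (movingAverageKernel E D φ x) (X x)

/-- `X` is the harmonizable field `X_ψ`. -/
def IsHarmonizable {d m : ℕ} {Ω : Type*} [MeasurableSpace Ω] (P : Measure Ω)
    (E : Matrix (Fin d) (Fin d) ℝ) (D : Matrix (Fin m) (Fin m) ℝ) (ψ : (Fin d → ℝ) → ℝ)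
    (X : (Fin d → ℝ) → Ω → (Fin m → ℝ)) : Prop :=
  ∃ W : Set (Fin d → ℝ) → Ω → (Fin m → ℂ), IsGaussianRandomMeasure P W ∧
    ∀ x, ∃ Z : Ω → (Fin m → ℂ), IsStochasticIntegral P W (harmonizableKernel E D ψ x) Z ∧
      ∀ᵐ ω ∂P, ∀ j, X x ω j = (Z ω j).re

/-! ### The modulus of continuity -/

/-- `Y` is a modification of `X` whose sample paths are almost surely continuous on `[0,1]^d`. -/
def IsContinuousModification {d m : ℕ} {Ω : Type*} [MeasurableSpace Ω] (P : Measure Ω)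
    (X Y : (Fin d → ℝ) → Ω → (Fin m → ℝ)) : Prop :=
  (∀ x, Y x =ᵐ[P] X x) ∧ ∀ᵐ ω ∂P, ContinuousOn (fun x => Y x ω) (Set.Icc 0 1)

/-- The `limsup` as `r ↓ 0` of the supremum, over distinct `x, y ∈ [0,1]^d` with `τ(x - y) ≤ r`, of
`|g(x) - g(y)| / (τ(x - y) ^ l * (log (1 / τ(x - y))) ^ (p - 1/2))`, as an element of `[0, ∞]`. -/
def modulusLimsup {d : ℕ} (τ : (Fin d → ℝ) → ℝ) (l : ℝ) (p : ℕ) (g : (Fin d → ℝ) → ℝ) : ℝ≥0∞ :=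
  limsup (fun r : ℝ => ⨆ (x ∈ Set.Icc (0 : Fin d → ℝ) 1) (y ∈ Set.Icc (0 : Fin d → ℝ) 1)
    (_ : x ≠ y ∧ τ (x - y) ≤ r),
      ENNReal.ofReal (|g x - g y| /
        (τ (x - y) ^ l * Real.log (1 / τ (x - y)) ^ ((p : ℝ) - 1 / 2)))) (𝓝[>] 0)

/-- `X` has modifications that are continuous on `[0,1]^d`, and each of them satisfies, for every
component, the modulus of continuity with the constant `C`, and the Hölder-type bounds. -/
def HasModulusOfContinuity {d m : ℕ} {Ω : Type*} [MeasurableSpace Ω] (P : Measure Ω)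
    (τ : (Fin d → ℝ) → ℝ) (lam : Fin m → ℝ) (p : Fin m → ℕ) (C : ℝ)
    (X : (Fin d → ℝ) → Ω → (Fin m → ℝ)) : Prop :=
  (∃ Y, IsContinuousModification P X Y) ∧
  ∀ Y, IsContinuousModification P X Y →
    (∀ j, ∀ᵐ ω ∂P, modulusLimsup τ (lam j) (p j) (fun x => Y x ω j) ≤ ENNReal.ofReal C) ∧
    ∀ ε : ℝ, 0 < ε → ∀ᵐ ω ∂P, ∃ K : ℝ, 0 < K ∧ ∀ j, ∀ x ∈ Set.Icc (0 : Fin d → ℝ) 1,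
      ∀ y ∈ Set.Icc (0 : Fin d → ℝ) 1, |Y x ω j - Y y ω j| ≤ K * τ (x - y) ^ (lam j - ε)

end OSS

end

/-!
The estimate is a chaining argument along the scales `τ_E ~ e⁻ⁿ`, fed by Gaussian tails of the
increments whose variances come from the self-similarity of the kernels.

*Linear algebra.* Write `flow A s = exp (s A)`, so that `c ^ A = flow A (log c)`. If all eigenvalues
of `E` have positive real part, then `flow E (-s)` contracts exponentially as `s → ∞`
(`exists_norm_flow_neg_le`): the eigenvalues of `exp (-E)` are the exponentials of those of `-E`,
and Gelfand's formula applies. For `D` in real canonical form, a cell is `a I + S + N` with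
commuting summands, `S` skew-symmetric and `N` nilpotent, and `N` shifts the blocks of rows of the
cell by one. Hence the `j`-th row of `flow D s` is `O(e^(s λ_j) (1 + |s|)^(p_j - 1))`, where `p_j`
is the number of blocks of rows of the cell of `j` that do not lie above `j`
(`IsRealCanonicalForm.exists_abs_flow_le`). This is the only place where the structure of `D`
enters.

*Variances.* Up to isometries of `L²`, both kernels `Q_x(y)` have stationary increments,
`Q_x - Q_x' ~ Q_(x - x')`, and are operator self-similar, `Q_(flow E s w) ~ flow D s · Q_w`: the
change of variables `y = flow E s z` (respectively `y = flow (-Eᵀ) s z`) has the Jacobian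
`e^(± s q)`, which the exponent `-q/2` of the kernel compensates (`IsScalingKernel`). The
square integrability of `Q_w` is contained in the assumption that the stochastic integral exists
(`IsStochasticIntegral.lintegral_lt_top`), and it is uniform on bounded sets of `w`: the squared
norm is bounded on some set of positive measure, hence, by stationarity and Steinhaus' theorem, on a
neighbourhood of the origin, hence, by scaling, on every ball
(`IsScalingKernel.exists_lintegral_le`). If `τ_E(x - y) ≤ e⁻ⁿ`, then `flow E n (x - y)` lies in a
fixed ball, and scaling back by `flow D (-n)` bounds the variance of `X_j(x) - X_j(y)` by a multiple
of `(e^(-λ_j n) (n + 1)^(p_j - 1))²`.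

*Tails.* The integrals of simple functions have explicit Gaussian moment generating functions;
Fatou's lemma passes the bound to differences of stochastic integrals, and Chernoff's bound turns it
into a tail estimate (`measure_le_abs_stochasticIntegral_sub_le`).

*Chaining.* The cube meets at most exponentially many cells of the grids `flow E (-n) ℤ^d`. By
Borel–Cantelli, almost surely all increments between neighbouring grid points on the scale `e⁻ⁿ`
are, for large `n`, at most a constant times `√(n + 1) · e^(-λ_j n) (n + 1)^(p_j - 1)`, which is
`chainWeight`; the factor `√(n + 1)` pays for the number of points and produces the exponent
`p_j - 1/2`. These weights are summable and submultiplicative, so the limits along the grids define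
a continuous modification with increments of the same order (`exists_ae_chain`). Any other
continuous modification coincides with it almost surely on the cube.
-/

noncomputable section

namespace OSS

/-! ### One-parameter groups of matrices -/

section
open scoped Matrix.Norms.Operator

/-- The one-parameter group `s ↦ exp (s A) = (e ^ s) ^ A`. -/
def flow {n : ℕ} (A : Matrix (Fin n) (Fin n) ℝ) (s : ℝ) : Matrix (Fin n) (Fin n) ℝ :=
  NormedSpace.exp (s • A)

variable {n : ℕ} (A : Matrix (Fin n) (Fin n) ℝ)

lemma matPow_eq_flow (c : ℝ) : matPow c A = flow A (Real.log c) := rfl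

lemma matPow_exp (s : ℝ) : matPow (Real.exp s) A = flow A s := by
  rw [matPow_eq_flow, Real.log_exp]

lemma flow_zero : flow A 0 = 1 := by simp [flow]

lemma flow_add (s t : ℝ) : flow A (s + t) = flow A s * flow A t := by
  rw [flow, add_smul]
  exact Matrix.exp_add_of_commute _ _ (((Commute.refl A).smul_left s).smul_right t)

lemma flow_mul_flow_neg (s : ℝ) : flow A s * flow A (-s) = 1 := by
  rw [← flow_add, add_neg_cancel, flow_zero]

lemma flow_neg_mul_flow (s : ℝ) : flow A (-s) * flow A s = 1 := by
  rw [← flow_add, neg_add_cancel, flow_zero]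

lemma flow_neg_left (s : ℝ) : flow (-A) s = flow A (-s) := by
  simp [flow]

lemma flow_transpose (s : ℝ) : flow Aᵀ s = (flow A s)ᵀ := by
  rw [flow, flow, ← Matrix.exp_transpose, Matrix.transpose_smul]

lemma flow_mulVec_add (s t : ℝ) (x : Fin n → ℝ) :
    flow A (s + t) *ᵥ x = flow A s *ᵥ (flow A t *ᵥ x) := by
  rw [flow_add, Matrix.mulVec_mulVec]

lemma flow_neg_mulVec_flow (s : ℝ) (x : Fin n → ℝ) : flow A (-s) *ᵥ (flow A s *ᵥ x) = x := by
  rw [Matrix.mulVec_mulVec, flow_neg_mul_flow, Matrix.one_mulVec]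

lemma flow_mulVec_flow_neg (s : ℝ) (x : Fin n → ℝ) : flow A s *ᵥ (flow A (-s) *ᵥ x) = x := by
  rw [Matrix.mulVec_mulVec, flow_mul_flow_neg, Matrix.one_mulVec]

lemma continuous_flow : Continuous (flow A) :=
  NormedSpace.exp_continuous.comp (continuous_id.smul continuous_const)

lemma flow_add_smul_one (c s : ℝ) : flow (A + c • 1) s = Real.exp (s * c) • flow A s := by
  have h : s • (A + c • 1) = s • A + algebraMap ℝ _ (s * c) := by
    rw [smul_add, smul_smul, Algebra.algebraMap_eq_smul_one]
  have hc : Commute (s • A) (algebraMap ℝ _ (s * c)) := (Algebra.commutes (s * c) (s • A)).symm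
  have he : NormedSpace.exp (algebraMap ℝ (Matrix (Fin n) (Fin n) ℝ) (s * c)) =
      algebraMap ℝ _ (Real.exp (s * c)) := by
    rw [Real.exp_eq_exp_ℝ]
    exact (NormedSpace.algebraMap_exp_comm (𝕂 := ℝ) (𝔸 := Matrix (Fin n) (Fin n) ℝ) (s * c)).symm
  rw [flow, h, Matrix.exp_add_of_commute _ _ hc, flow, he, ← Algebra.commutes,
    Algebra.algebraMap_eq_smul_one, smul_mul_assoc, one_mul]

lemma hasDerivAt_flow_apply (i j : Fin n) :
    HasDerivAt (fun s => flow A s i j) (A i j) 0 := by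
  have h := hasDerivAt_exp_smul_const (𝕂 := ℝ) A (0 : ℝ)
  rw [zero_smul, NormedSpace.exp_zero, one_mul] at h
  have hl : HasFDerivAt (fun M : Matrix (Fin n) (Fin n) ℝ => M i j)
      (LinearMap.toContinuousLinearMap (Matrix.entryLinearMap ℝ ℝ i j))
      (NormedSpace.exp ((0 : ℝ) • A)) :=
    (LinearMap.toContinuousLinearMap (Matrix.entryLinearMap ℝ ℝ i j)).hasFDerivAt
  exact hl.comp_hasDerivAt (0 : ℝ) h

lemma hasDerivAt_det_flow_zero : HasDerivAt (fun s => (flow A s).det) A.trace 0 := by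
  have h : ∀ σ : Equiv.Perm (Fin n), HasDerivAt
      (fun s => ((Equiv.Perm.sign σ : ℤ) : ℝ) * ∏ i, flow A s (σ i) i)
      (((Equiv.Perm.sign σ : ℤ) : ℝ) *
        ∑ i, (∏ j ∈ Finset.univ.erase i, flow A 0 (σ j) j) • A (σ i) i) 0 := fun σ =>
    (HasDerivAt.fun_finsetProd fun i _ => hasDerivAt_flow_apply A (σ i) i).const_mul _
  have h' := HasDerivAt.fun_sum fun σ (_ : σ ∈ Finset.univ) => h σ
  simp only [Matrix.det_apply']
  refine h'.congr_deriv ?_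
  rw [Finset.sum_eq_single (1 : Equiv.Perm (Fin n))]
  · simp [flow_zero, Matrix.trace]
  · intro σ _ hσ
    -- a nontrivial permutation moves two points, so a zero factor survives the erasure of one
    refine mul_eq_zero_of_right _ (Finset.sum_eq_zero fun i _ => ?_)
    obtain ⟨j, hj, hji⟩ : ∃ j, σ j ≠ j ∧ j ≠ i := by
      obtain ⟨k, hk⟩ : ∃ k, σ k ≠ k := by
        by_contra! hc; exact hσ (Equiv.ext hc)
      by_cases hki : k = i
      · exact ⟨σ k, fun hc => hk (σ.injective hc), fun hc => hk (hc.trans hki.symm)⟩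
      · exact ⟨k, hk, hki⟩
    rw [Finset.prod_eq_zero (i := j), zero_smul]
    · simp [hji]
    · simp [flow_zero, hj]
  · simp

/-- Liouville's formula: the logarithmic derivative of the determinant is the trace. -/
lemma det_flow (s : ℝ) : (flow A s).det = Real.exp (s * A.trace) := by
  have hd : ∀ s, HasDerivAt (fun s => (flow A s).det) ((flow A s).det * A.trace) s := fun s => by
    have h0 := hasDerivAt_det_flow_zero A
    rw [← sub_self s] at h0
    have h := (h0.comp_sub_const s s).const_mul (flow A s).det
    refine h.congr_of_eventuallyEq (Eventually.of_forall fun t => ?_)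
    simp only
    rw [← Matrix.det_mul, ← flow_add, add_sub_cancel]
  have hc : ∀ s, HasDerivAt (fun s => (flow A s).det * Real.exp (-(s * A.trace))) 0 s := fun s => by
    have h := (hd s).mul (((hasDerivAt_id s).mul_const A.trace).neg.exp)
    refine h.congr_deriv ?_
    simp; ring
  have h := is_const_of_deriv_eq_zero (fun s => (hc s).differentiableAt) (fun s => (hc s).deriv) s 0
  simp only [flow_zero, Matrix.det_one, zero_mul, neg_zero, Real.exp_zero, mul_one] at h
  rwa [Real.exp_neg, mul_inv_eq_one₀ (Real.exp_pos _).ne'] at h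

lemma norm_flow_le (s : ℝ) : ‖flow A s‖ ≤ Real.exp (‖A‖ * |s|) := by
  rcases isEmpty_or_nonempty (Fin n) with hn | hn
  · rw [Subsingleton.elim (flow A s) 0, norm_zero]; positivity
  have h1 := NormedSpace.exp_series_hasSum_exp' (𝕂 := ℝ) (s • A)
  have h2 := NormedSpace.exp_series_hasSum_exp' (𝕂 := ℝ) ‖s • A‖
  rw [← Real.exp_eq_exp_ℝ] at h2
  have h3 : ‖s • A‖ = ‖A‖ * |s| := by rw [norm_smul, Real.norm_eq_abs, mul_comm]
  rw [← h3]
  refine h1.norm_le_of_bounded h2 fun k => ?_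
  rw [norm_smul, smul_eq_mul, norm_inv, RCLike.norm_natCast]
  gcongr
  exact norm_pow_le _ _

lemma exists_norm_flow_mulVec_le : ∃ κ : ℝ, 0 ≤ κ ∧ ∀ (s : ℝ) (x : Fin n → ℝ),
    ‖flow A s *ᵥ x‖ ≤ Real.exp (κ * |s|) * ‖x‖ :=
  ⟨‖A‖, norm_nonneg A, fun s _ =>
    (Matrix.linfty_opNorm_mulVec _ _).trans (by gcongr; exact norm_flow_le A s)⟩

/-- The eigenvalues of `exp B` are exponentials of eigenvalues of `B`: `B` leaves the eigenspaces of
`exp B` invariant, so each of them contains an eigenvector of `B`. -/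
lemma mem_spectrum_of_mem_spectrum_exp (B : Matrix (Fin n) (Fin n) ℂ) {μ : ℂ}
    (h : μ ∈ spectrum ℂ (NormedSpace.exp B)) : ∃ ν ∈ spectrum ℂ B, Complex.exp ν = μ := by
  rw [← Matrix.spectrum_toLin', ← Module.End.hasEigenvalue_iff_mem_spectrum] at h
  have hcomm : Commute (Matrix.toLin' B) (Matrix.toLin' (NormedSpace.exp B)) := by
    have h := (Commute.refl B).exp_right
    rw [Commute, SemiconjBy, Module.End.mul_eq_comp, Module.End.mul_eq_comp,
      ← Matrix.toLin'_mul, ← Matrix.toLin'_mul, h.eq]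
  set W := Module.End.eigenspace (Matrix.toLin' (NormedSpace.exp B)) μ with hW
  have hmap : ∀ x ∈ W, Matrix.toLin' B x ∈ W :=
    Module.End.mapsTo_genEigenspace_of_comm hcomm.symm μ 1
  have : Nontrivial W := (Submodule.nontrivial_iff_ne_bot).2 h
  obtain ⟨ν, hν⟩ := Module.End.exists_eigenvalue ((Matrix.toLin' B).restrict hmap)
  obtain ⟨w, hw⟩ := hν.exists_hasEigenvector
  have hBw : B *ᵥ (w : Fin n → ℂ) = ν • (w : Fin n → ℂ) := by
    have := congrArg Subtype.val hw.apply_eq_smul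
    simpa using this
  have hw0 : (w : Fin n → ℂ) ≠ 0 := fun hc => hw.2 (Subtype.ext hc)
  have hexp : NormedSpace.exp B *ᵥ (w : Fin n → ℂ) = μ • (w : Fin n → ℂ) := by
    simpa using Module.End.mem_eigenspace_iff.1 w.2
  have hpow : ∀ k : ℕ, (B ^ k) *ᵥ (w : Fin n → ℂ) = ν ^ k • (w : Fin n → ℂ) := fun k => by
    induction k with
    | zero => simp
    | succ k ih =>
      rw [pow_succ, ← Matrix.mulVec_mulVec, hBw, Matrix.mulVec_smul, ih, smul_smul, pow_succ,
        mul_comm]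
  refine ⟨ν, ?_, ?_⟩
  · rw [← Matrix.spectrum_toLin', ← Module.End.hasEigenvalue_iff_mem_spectrum]
    exact Module.End.hasEigenvalue_of_hasEigenvector
      (x := (w : Fin n → ℂ)) ⟨Module.End.mem_eigenspace_iff.2 (by simpa using hBw), hw0⟩
  · have h1 := NormedSpace.exp_series_hasSum_exp' (𝕂 := ℂ) B
    have hl : Continuous (fun M : Matrix (Fin n) (Fin n) ℂ => M *ᵥ (w : Fin n → ℂ)) :=
      continuous_id.matrix_mulVec continuous_const
    have h2 := h1.map (Matrix.mulVecBilin ℂ ℂ |>.flip (w : Fin n → ℂ)) hl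
    have h3 := (NormedSpace.exp_series_hasSum_exp' (𝕂 := ℂ) ν).smul_const (w : Fin n → ℂ)
    have h4 : ((fun M : Matrix (Fin n) (Fin n) ℂ => M *ᵥ (w : Fin n → ℂ)) ∘
        fun k : ℕ => ((k.factorial : ℂ)⁻¹) • B ^ k)
        = fun k : ℕ => ((k.factorial : ℂ)⁻¹ • ν ^ k) • (w : Fin n → ℂ) := by
      funext k
      simp [Matrix.smul_mulVec, hpow, smul_smul]
    have h5 := h2.unique (h4 ▸ h3)
    obtain ⟨i, hi⟩ := Function.ne_iff.1 hw0
    have h6 : (NormedSpace.exp B *ᵥ (w : Fin n → ℂ)) i = (NormedSpace.exp ν • (w : Fin n → ℂ)) i :=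
      congrFun h5 i
    rw [hexp, Pi.smul_apply, Pi.smul_apply, smul_eq_mul, smul_eq_mul, ← Complex.exp_eq_exp_ℂ] at h6
    exact (mul_right_cancel₀ hi h6).symm

/-- A matrix whose eigenvalues all have positive real part contracts exponentially in backward
time: by Gelfand's formula some power of `exp (-A)` has norm less than one. -/
lemma exists_norm_flow_neg_le (hA : ∀ μ ∈ spectrum ℂ (A.map Complex.ofReal), 0 < μ.re) :
    ∃ C δ : ℝ, 0 < C ∧ 0 < δ ∧ ∀ s, 0 ≤ s → ‖flow A (-s)‖ ≤ C * Real.exp (-(δ * s)) := by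
  obtain ⟨k, hk, hkn⟩ : ∃ k : ℕ, 0 < k ∧ ‖flow A (-k)‖ < 1 := by
    rcases isEmpty_or_nonempty (Fin n) with hn | hn
    · exact ⟨1, one_pos, by rw [Subsingleton.elim (flow A _) 0, norm_zero]; exact one_pos⟩
    have hmap : NormedSpace.exp (-(A.map Complex.ofReal)) = (flow A (-1)).map Complex.ofReal := by
      have := NormedSpace.map_exp (Complex.ofRealHom.mapMatrix (m := Fin n))
        (continuous_id.matrix_map Complex.continuous_ofReal) ((-1 : ℝ) • A)
      rw [flow]
      refine Eq.trans ?_ this.symm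
      congr 1
      ext i j; simp
    have hr : spectralRadius ℂ (NormedSpace.exp (-(A.map Complex.ofReal))) < (1 : NNReal) := by
      refine spectrum.spectralRadius_lt_of_forall_lt _ fun μ hμ => ?_
      obtain ⟨ν, hν, rfl⟩ := mem_spectrum_of_mem_spectrum_exp _ hμ
      have := hA (-ν) (by rw [← Set.mem_neg, spectrum.neg_eq]; exact hν)
      rw [← NNReal.coe_lt_coe, coe_nnnorm, Complex.norm_exp, NNReal.coe_one, Real.exp_lt_one_iff]
      simpa using this
    have ht := spectrum.pow_nnnorm_pow_one_div_tendsto_nhds_spectralRadius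
      (NormedSpace.exp (-(A.map Complex.ofReal)))
    obtain ⟨k, hk1, hk2⟩ := ((ht.eventually_lt_const hr).and (eventually_gt_atTop 0)).exists
    refine ⟨k, hk2, ?_⟩
    have hlt : (‖NormedSpace.exp (-(A.map Complex.ofReal)) ^ k‖₊ : ℝ≥0∞) < 1 := by
      by_contra! hc
      exact absurd (ENNReal.one_le_rpow hc (by positivity)) (not_le.2 hk1)
    have hpow : flow A (-k) = flow A (-1) ^ k := by
      rw [flow, flow, ← Matrix.exp_nsmul]; congr 1; ext; simp
    have hmap' : NormedSpace.exp (-(A.map Complex.ofReal)) ^ k =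
        (flow A (-k)).map Complex.ofReal := by
      rw [hmap, hpow]
      exact (map_pow (Complex.ofRealHom.mapMatrix (m := Fin n)) (flow A (-1)) k).symm
    have hn1 : ‖(flow A (-k)).map Complex.ofReal‖ = ‖flow A (-k)‖ := by
      simp [Matrix.linfty_opNorm_def]
    rw [hmap', ENNReal.coe_lt_one_iff, ← NNReal.coe_lt_coe, coe_nnnorm, hn1, NNReal.coe_one] at hlt
    exact hlt
  -- the maximum keeps the logarithm of `ρ` finite when the power vanishes (`n = 0`)
  set ρ := max ‖flow A (-k)‖ (1 / 2) with hρ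
  have hρ0 : 0 < ρ := lt_max_of_lt_right (by norm_num)
  have hρ1 : ρ < 1 := max_lt hkn (by norm_num)
  have hk' : (0 : ℝ) < k := by exact_mod_cast hk
  set δ := -Real.log ρ / k with hδ
  have hδ0 : 0 < δ := div_pos (neg_pos.2 (Real.log_neg hρ0 hρ1)) hk'
  set M := Real.exp (‖A‖ * k) with hM
  refine ⟨‖(1 : Matrix (Fin n) (Fin n) ℝ)‖ * M * Real.exp (δ * k) + 1, δ, by positivity, hδ0,
    fun s hs => ?_⟩
  set l := ⌊s / k⌋₊ with hl
  have hl1 : l * k ≤ s := (le_div_iff₀ hk').1 (Nat.floor_le (by positivity))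
  have hl2 : s < (l + 1) * k := (div_lt_iff₀ hk').1 (Nat.lt_floor_add_one _)
  have hpow : flow A (-(l * k : ℝ)) = flow A (-k) ^ l := by
    rw [flow, flow, ← Matrix.exp_nsmul]; congr 1; ext; simp; ring
  have h1 : ‖flow A (-(l * k : ℝ))‖ ≤ ‖(1 : Matrix (Fin n) (Fin n) ℝ)‖ * ρ ^ l := by
    rw [hpow, ← one_mul (flow A (-k) ^ l)]
    clear hpow hl1 hl2 hl
    induction l with
    | zero => simp
    | succ l ih =>
      rw [pow_succ, ← mul_assoc, pow_succ ρ, ← mul_assoc ‖_‖]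
      exact (norm_mul_le _ _).trans
        (mul_le_mul ih (le_max_left _ _) (norm_nonneg _) (by positivity))
  have h2 : ‖flow A (-(s - l * k))‖ ≤ M := by
    refine (norm_flow_le A _).trans (Real.exp_le_exp.2 ?_)
    rw [abs_neg, abs_of_nonneg (by linarith)]
    gcongr
    linarith
  have h3 : ρ ^ l ≤ Real.exp (δ * k) * Real.exp (-(δ * s)) := by
    have hlog : Real.log ρ = -(δ * k) := by rw [hδ]; field_simp
    rw [← Real.exp_log hρ0, ← Real.exp_nat_mul, ← Real.exp_add, hlog]
    refine Real.exp_le_exp.2 ?_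
    nlinarith
  have h4 : flow A (-s) = flow A (-(l * k : ℝ)) * flow A (-(s - l * k)) := by
    rw [← flow_add]; congr 1; ring
  rw [h4]
  refine (norm_mul_le _ _).trans ((mul_le_mul h1 h2 (norm_nonneg _) (by positivity)).trans ?_)
  calc ‖(1 : Matrix (Fin n) (Fin n) ℝ)‖ * ρ ^ l * M
      ≤ ‖(1 : Matrix (Fin n) (Fin n) ℝ)‖ * (Real.exp (δ * k) * Real.exp (-(δ * s))) * M := by gcongr
    _ ≤ _ := by
      have := Real.exp_pos (-(δ * s))
      nlinarith

lemma exists_norm_flow_neg_mulVec_le (hA : ∀ μ ∈ spectrum ℂ (A.map Complex.ofReal), 0 < μ.re) :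
    ∃ C δ : ℝ, 0 < C ∧ 0 < δ ∧ ∀ s, 0 ≤ s → ∀ x : Fin n → ℝ,
      ‖flow A (-s) *ᵥ x‖ ≤ C * Real.exp (-(δ * s)) * ‖x‖ := by
  obtain ⟨C, δ, hC, hδ, h⟩ := exists_norm_flow_neg_le A hA
  exact ⟨C, δ, hC, hδ, fun s hs x =>
    (Matrix.linfty_opNorm_mulVec _ _).trans (by gcongr; exact h s hs)⟩

end

/-! ### The exponential of a matrix in real canonical form -/

section
open scoped Matrix.Norms.Operator

/-- Matrices of size `k` whose index set is graded by `g < l`, and which raise the degree by one,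
are nilpotent; the `i`-th row of the exponential is a polynomial of degree at most `l - 1 - g i`. -/
lemma exists_abs_exp_apply_le_of_graded {k l : ℕ} (N : Matrix (Fin k) (Fin k) ℝ) (g : Fin k → ℕ)
    (hg : ∀ i, g i < l) (hN : ∀ i j, N i j ≠ 0 → g j = g i + 1) :
    ∃ C, 0 < C ∧ ∀ s : ℝ, ∀ i j,
      |NormedSpace.exp (s • N) i j| ≤ C * (1 + |s|) ^ (l - g i - 1) := by
  have hpow : ∀ (a : ℕ) i j, (N ^ a) i j ≠ 0 → g j = g i + a := by
    intro a
    induction a with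
    | zero => intro i j h; rw [pow_zero, Matrix.one_apply] at h; aesop
    | succ a ih =>
      intro i j h
      rw [pow_succ, Matrix.mul_apply] at h
      obtain ⟨q, -, hq⟩ := Finset.exists_ne_zero_of_sum_ne_zero h
      rw [hN q j (right_ne_zero_of_mul hq), ih i q (left_ne_zero_of_mul hq), add_assoc]
  have hent : ∀ (s : ℝ) i j, NormedSpace.exp (s • N) i j =
      ∑ a ∈ Finset.range (l - g i), ((a.factorial : ℝ)⁻¹ * s ^ a) * (N ^ a) i j := by
    intro s i j
    have h1 := NormedSpace.exp_series_hasSum_exp' (𝕂 := ℝ) (s • N)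
    have h2 := h1.map (Matrix.entryLinearMap ℝ ℝ i j)
      (LinearMap.continuous_of_finiteDimensional _)
    refine h2.unique ?_
    have h3 : ((Matrix.entryLinearMap ℝ ℝ i j) ∘ fun a : ℕ => ((a.factorial : ℝ)⁻¹) • (s • N) ^ a) =
        fun a => ((a.factorial : ℝ)⁻¹ * s ^ a) * (N ^ a) i j := by
      funext a; simp [smul_pow, mul_assoc]
    rw [h3]
    refine hasSum_sum_of_ne_finset_zero fun a ha => ?_
    by_contra hc
    have := hpow a i j (right_ne_zero_of_mul hc)
    have := hg j
    rw [Finset.mem_range] at ha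
    omega
  refine ⟨1 + ∑ i, ∑ j, ∑ a ∈ Finset.range l, |(N ^ a) i j|, by positivity, fun s i j => ?_⟩
  rw [hent]
  calc |∑ a ∈ Finset.range (l - g i), ((a.factorial : ℝ)⁻¹ * s ^ a) * (N ^ a) i j|
      ≤ ∑ a ∈ Finset.range (l - g i), |(N ^ a) i j| * (1 + |s|) ^ (l - g i - 1) := by
        refine (Finset.abs_sum_le_sum_abs _ _).trans (Finset.sum_le_sum fun a ha => ?_)
        rw [Finset.mem_range] at ha
        rw [abs_mul, mul_comm, abs_mul, abs_pow]
        gcongr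
        have h1 : |((a.factorial : ℝ)⁻¹)| ≤ 1 := by
          rw [abs_of_nonneg (by positivity)]
          exact inv_le_one_of_one_le₀
            (by exact_mod_cast Nat.one_le_iff_ne_zero.2 a.factorial_ne_zero)
        calc |((a.factorial : ℝ)⁻¹)| * |s| ^ a ≤ 1 * (1 + |s|) ^ a := by
              gcongr; linarith
          _ ≤ _ := by
              rw [one_mul]
              exact pow_le_pow_right₀ (by linarith [abs_nonneg s]) (by omega)
    _ = (∑ a ∈ Finset.range (l - g i), |(N ^ a) i j|) * (1 + |s|) ^ (l - g i - 1) := by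
        rw [Finset.sum_mul]
    _ ≤ _ := by
        gcongr
        calc ∑ a ∈ Finset.range (l - g i), |(N ^ a) i j| ≤ ∑ a ∈ Finset.range l, |(N ^ a) i j| :=
              Finset.sum_le_sum_of_subset_of_nonneg (Finset.range_mono (by omega))
                fun _ _ _ => abs_nonneg _
          _ ≤ ∑ j, ∑ a ∈ Finset.range l, |(N ^ a) i j| :=
              Finset.single_le_sum (f := fun j => ∑ a ∈ Finset.range l, |(N ^ a) i j|)
                (fun _ _ => by positivity) (Finset.mem_univ j)
          _ ≤ ∑ i, ∑ j, ∑ a ∈ Finset.range l, |(N ^ a) i j| :=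
              Finset.single_le_sum (f := fun i => ∑ j, ∑ a ∈ Finset.range l, |(N ^ a) i j|)
                (fun _ _ => by positivity) (Finset.mem_univ i)
          _ ≤ _ := by linarith

/-- The exponential of a skew-symmetric matrix is orthogonal, hence has bounded entries. -/
lemma abs_exp_apply_le_one_of_skew {k : ℕ} (S : Matrix (Fin k) (Fin k) ℝ) (hS : Sᵀ = -S)
    (i j : Fin k) :
    |NormedSpace.exp S i j| ≤ 1 := by
  have h1 : (NormedSpace.exp S)ᵀ * NormedSpace.exp S = 1 := by
    rw [← Matrix.exp_transpose, hS, ← Matrix.exp_add_of_commute _ _ (Commute.refl S).neg_left,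
      neg_add_cancel, NormedSpace.exp_zero]
  have h2 := congrFun (congrFun h1 j) j
  rw [Matrix.mul_apply, Matrix.one_apply_eq] at h2
  rw [← sq_le_one_iff_abs_le_one, ← h2]
  simp only [Matrix.transpose_apply, ← sq]
  exact Finset.single_le_sum (f := fun a => NormedSpace.exp S a j ^ 2) (fun _ _ => sq_nonneg _)
    (Finset.mem_univ i)

/-- The rows of the exponential of a cell `N + S + a I`: the three summands commute, and the factor
`exp (s S)` is orthogonal. -/
lemma exists_abs_exp_apply_le {k l : ℕ} (a : ℝ) (S N : Matrix (Fin k) (Fin k) ℝ) (hS : Sᵀ = -S)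
    (hSN : Commute S N) (g : Fin k → ℕ) (hg : ∀ i, g i < l)
    (hN : ∀ i j, N i j ≠ 0 → g j = g i + 1) :
    ∃ C, 0 < C ∧ ∀ s : ℝ, ∀ i j,
      |flow (N + S + a • 1) s i j| ≤ C * (Real.exp (s * a) * (1 + |s|) ^ (l - g i - 1)) := by
  obtain ⟨C, hC, h⟩ := exists_abs_exp_apply_le_of_graded N g hg hN
  refine ⟨C * k + 1, by positivity, fun s i j => ?_⟩
  have he : flow (N + S) s = NormedSpace.exp (s • N) * NormedSpace.exp (s • S) := by
    rw [flow, smul_add, Matrix.exp_add_of_commute _ _ ((hSN.symm.smul_left s).smul_right s)]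
  have hS' : (s • S)ᵀ = -(s • S) := by rw [Matrix.transpose_smul, hS, smul_neg]
  rw [flow_add_smul_one, he, Matrix.smul_apply, smul_eq_mul, abs_mul, abs_of_pos (Real.exp_pos _),
    Matrix.mul_apply]
  calc Real.exp (s * a) * |∑ q, NormedSpace.exp (s • N) i q * NormedSpace.exp (s • S) q j|
      ≤ Real.exp (s * a) * ∑ q : Fin k, C * (1 + |s|) ^ (l - g i - 1) := by
        gcongr
        refine (Finset.abs_sum_le_sum_abs _ _).trans (Finset.sum_le_sum fun q _ => ?_)
        rw [abs_mul]
        calc _ ≤ C * (1 + |s|) ^ (l - g i - 1) * 1 :=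
              mul_le_mul (h s i q) (abs_exp_apply_le_one_of_skew _ hS' q j) (abs_nonneg _)
                (by positivity)
          _ = _ := mul_one _
    _ = (C * k) * (Real.exp (s * a) * (1 + |s|) ^ (l - g i - 1)) := by
        rw [Finset.sum_const, Finset.card_univ, Fintype.card_fin, nsmul_eq_mul]; ring
    _ ≤ _ := by gcongr; linarith

/-- In a cell, `p i - 1` is the number of (blocks of) rows below the row `i`. -/
lemma RealCell.exists_abs_flow_le (c : RealCell) :
    ∃ p : Fin c.size → ℕ, (∀ i, 1 ≤ p i ∧ p i ≤ c.size) ∧ ∃ C, 0 < C ∧ ∀ s : ℝ, ∀ i j,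
      |flow c.toMatrix s i j| ≤ C * (Real.exp (s * c.re) * (1 + |s|) ^ (p i - 1)) := by
  cases c with
  | real n a =>
    set N : Matrix (Fin n) (Fin n) ℝ := Matrix.of fun i j =>
      if (i : ℕ) + 1 = j then 1 else 0 with hN
    obtain ⟨C, hC, h⟩ := exists_abs_exp_apply_le (k := n) (l := n) a 0 N (by simp)
      (Commute.zero_left _) (fun i => i) (fun i => i.2) (by intro i j hij; simp [hN] at hij; omega)
    refine ⟨fun i => n - i, fun i => ?_, C, hC, fun s i j => ?_⟩
    · have := i.2
      simp only [RealCell.size] at this ⊢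
      omega
    · have hM : N + 0 + a • 1 = (RealCell.real n a).toMatrix := by
        ext i j
        simp only [RealCell.toMatrix, hN, Matrix.add_apply, Matrix.of_apply, Matrix.smul_apply,
          Matrix.one_apply, Matrix.zero_apply, Fin.ext_iff, smul_eq_mul]
        split_ifs <;> first | omega | simp
      have := h s i j
      rw [hM] at this
      exact this
  | complex n a b hb =>
    set S : Matrix (Fin (2 * n)) (Fin (2 * n)) ℝ := Matrix.of fun i j =>
      if (i : ℕ) / 2 = (j : ℕ) / 2 ∧ (i : ℕ) % 2 ≠ (j : ℕ) % 2 then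
        (if (i : ℕ) % 2 = 0 then -b else b) else 0 with hS
    set N : Matrix (Fin (2 * n)) (Fin (2 * n)) ℝ := Matrix.of fun i j =>
      if (i : ℕ) + 2 = j then 1 else 0 with hN
    have hSN : Commute S N := by
      ext i j
      rw [Matrix.mul_apply, Matrix.mul_apply]
      have h1 : ∑ q, S i q * N q j =
          if (i : ℕ) / 2 + 1 = (j : ℕ) / 2 ∧ (i : ℕ) % 2 ≠ (j : ℕ) % 2 then
            (if (i : ℕ) % 2 = 0 then -b else b) else 0 := by
        by_cases hj : 2 ≤ (j : ℕ)
        · rw [Finset.sum_eq_single (⟨j - 2, by omega⟩ : Fin (2 * n))]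
          · have e1 : ((j : ℕ) - 2) % 2 = (j : ℕ) % 2 := by omega
            have e2 : ((i : ℕ) / 2 = ((j : ℕ) - 2) / 2) ↔ ((i : ℕ) / 2 + 1 = (j : ℕ) / 2) := by
              omega
            simp [hS, hN, e1, e2, Nat.sub_add_cancel hj]
          · intro q _ hq
            have : ¬ (q : ℕ) + 2 = j := fun h => hq (Fin.ext (by simp; omega))
            simp [hN, this]
          · simp
        · rw [Finset.sum_eq_zero fun q _ => ?_, if_neg (by omega)]
          have : ¬ (q : ℕ) + 2 = j := by omega
          simp [hN, this]
      have h2 : ∑ q, N i q * S q j =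
          if (i : ℕ) / 2 + 1 = (j : ℕ) / 2 ∧ (i : ℕ) % 2 ≠ (j : ℕ) % 2 then
            (if (i : ℕ) % 2 = 0 then -b else b) else 0 := by
        by_cases hi : (i : ℕ) + 2 < 2 * n
        · rw [Finset.sum_eq_single (⟨i + 2, hi⟩ : Fin (2 * n))]
          · have e2 : ((i : ℕ) + 2) / 2 = (i : ℕ) / 2 + 1 := by omega
            simp [hS, hN, e2]
          · intro q _ hq
            have : ¬ (i : ℕ) + 2 = q := fun h => hq (Fin.ext (by simp; omega))
            simp [hN, this]
          · simp
        · have := j.2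
          rw [Finset.sum_eq_zero fun q _ => ?_, if_neg (by omega)]
          have : ¬ (i : ℕ) + 2 = q := by omega
          simp [hN, this]
      rw [h1, h2]
    have hskew : Sᵀ = -S := by
      ext i j
      simp only [hS, Matrix.transpose_apply, Matrix.of_apply, Matrix.neg_apply]
      split_ifs <;> first | omega | simp
    obtain ⟨C, hC, h⟩ := exists_abs_exp_apply_le (k := 2 * n) (l := n) a S N hskew hSN
      (fun i => (i : ℕ) / 2) (fun i => by have := i.2; omega)
      (by intro i j hij; simp [hN] at hij; omega)
    refine ⟨fun i => n - (i : ℕ) / 2, fun i => ?_, C, hC, fun s i j => ?_⟩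
    · have := i.2
      simp only [RealCell.size] at this ⊢
      omega
    · have hM : N + S + a • 1 = (RealCell.complex n a b hb).toMatrix := by
        ext i j
        simp only [RealCell.toMatrix, hS, hN, Matrix.add_apply, Matrix.of_apply,
          Matrix.smul_apply, Matrix.one_apply, Fin.ext_iff, smul_eq_mul]
        split_ifs <;> first | omega | simp
      have := h s i j
      rw [hM] at this
      exact this

/-- Growth of the rows of `c ^ D` for `D` in real canonical form. -/
lemma IsRealCanonicalForm.exists_abs_flow_le {m : ℕ} {D : Matrix (Fin m) (Fin m) ℝ}
    {lam : Fin m → ℝ} (hD : IsRealCanonicalForm D lam) :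
    ∃ p : Fin m → ℕ, (∀ j, 1 ≤ p j ∧ p j ≤ m) ∧ ∃ C, 0 < C ∧ ∀ s : ℝ, ∀ i j,
      |flow D s i j| ≤ C * (Real.exp (s * lam i) * (1 + |s|) ^ (p i - 1)) := by
  obtain ⟨k, cell, e, hcell, hlam⟩ := hD
  choose p hp C hC h using fun i => (cell i).exists_abs_flow_le
  set f : (Σ i : Fin k, Fin (cell i).size) ≃ Fin m := toLex.trans e.toEquiv with hf
  have hfD : D = Matrix.reindex f f (Matrix.blockDiagonal' fun i => (cell i).toMatrix) := by
    ext a b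
    have := hcell (f.symm a) (f.symm b)
    simp only [Matrix.reindex_apply, Matrix.submatrix_apply]
    rw [← this]
    congr 1 <;> exact (f.apply_symm_apply _).symm
  have hflow : ∀ s, flow D s =
      Matrix.reindex f f (Matrix.blockDiagonal' fun i => flow (cell i).toMatrix s) := by
    intro s
    have h1 := NormedSpace.map_exp (Matrix.reindexAlgEquiv ℝ ℝ f)
      (continuous_id.matrix_reindex f f) (s • Matrix.blockDiagonal' fun i => (cell i).toMatrix)
    have h2 := Matrix.exp_blockDiagonal' (s • fun i => (cell i).toMatrix)
    rw [Matrix.blockDiagonal'_smul] at h2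
    rw [hfD, flow]
    refine h1.symm.trans (congrArg (Matrix.reindexAlgEquiv ℝ ℝ f) (h2.trans ?_))
    congr 1
    exact Pi.exp_def (fun i => s • (cell i).toMatrix)
  have hsize : ∀ i, (cell i).size ≤ m := fun i => by
    simpa using Fintype.card_le_of_injective (fun x : Fin (cell i).size => f ⟨i, x⟩)
      (f.injective.comp sigma_mk_injective)
  refine ⟨fun j => p (f.symm j).1 (f.symm j).2, fun j => ⟨(hp _ _).1, (hp _ _).2.trans (hsize _)⟩,
    1 + ∑ i, C i, by
      have := Finset.sum_nonneg fun i (_ : i ∈ Finset.univ) => (hC i).le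
      positivity, fun s i j => ?_⟩
  have hl : lam i = (cell (f.symm i).1).re := by
    rw [← hlam]; congr 1; exact (f.apply_symm_apply _).symm
  rw [hflow, Matrix.reindex_apply, Matrix.submatrix_apply, hl]
  dsimp only
  obtain ⟨a, x⟩ := f.symm i
  obtain ⟨b, y⟩ := f.symm j
  by_cases hab : a = b
  · subst hab
    rw [Matrix.blockDiagonal'_apply_eq]
    have hCa : C a ≤ 1 + ∑ i, C i := by
      have := Finset.single_le_sum (f := C) (fun i _ => (hC i).le) (Finset.mem_univ a)
      linarith
    exact (h a s x y).trans (mul_le_mul_of_nonneg_right hCa (by positivity))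
  · rw [Matrix.blockDiagonal'_apply_ne _ _ _ hab, abs_zero]
    have := Finset.sum_nonneg fun i (_ : i ∈ Finset.univ) => (hC i).le
    positivity

end

/-! ### Estimates for the radial part -/

section Radius

variable {d : ℕ} (E : Matrix (Fin d) (Fin d) ℝ) (N : Seminorm ℝ (Fin d → ℝ))

lemma exists_seminorm_le : ∃ C, 0 < C ∧ ∀ x, N x ≤ C * ‖x‖ := by
  have h0 : 0 ≤ ∑ i, N (Pi.single i 1) := Finset.sum_nonneg fun _ _ => apply_nonneg _ _
  refine ⟨1 + ∑ i, N (Pi.single i 1), by positivity, fun x => ?_⟩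
  calc N x = N (∑ i, x i • Pi.single i (1 : ℝ)) := by
        congr 1; ext j; simp [Finset.sum_apply, Pi.single_apply]
    _ ≤ ∑ i, N (x i • Pi.single i (1 : ℝ)) := by
        refine Finset.le_sum_of_subadditive N (map_zero N).le (map_add_le_add N) _ _
    _ ≤ ∑ i, ‖x‖ * N (Pi.single i 1) := by
        refine Finset.sum_le_sum fun i _ => ?_
        rw [map_smul_eq_mul]
        gcongr
        exact norm_le_pi_norm x i
    _ = (∑ i, N (Pi.single i 1)) * ‖x‖ := by rw [← Finset.mul_sum, mul_comm]
    _ ≤ _ := by gcongr; linarith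

lemma continuous_seminorm : Continuous N := by
  obtain ⟨C, hC, h⟩ := exists_seminorm_le N
  refine (LipschitzWith.of_dist_le_mul (K := ⟨C, hC.le⟩) fun x y => ?_).continuous
  rw [Real.dist_eq, dist_eq_norm]
  exact (abs_sub_map_le_sub N x y).trans (h _)

lemma exists_norm_le_seminorm (hN : ∀ x, N x = 0 → x = 0) : ∃ C, 0 < C ∧ ∀ x, ‖x‖ ≤ C * N x := by
  by_cases hd : (Metric.sphere (0 : Fin d → ℝ) 1).Nonempty
  · obtain ⟨z, hz, hmin⟩ := (isCompact_sphere (0 : Fin d → ℝ) 1).exists_isMinOn hd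
      (continuous_seminorm N).continuousOn
    have hz1 : ‖z‖ = 1 := by simpa using hz
    have hNz : 0 < N z := lt_of_le_of_ne (apply_nonneg _ _) fun h => by
      rw [hN z h.symm, norm_zero] at hz1; exact zero_ne_one hz1
    refine ⟨(N z)⁻¹, inv_pos.2 hNz, fun x => ?_⟩
    rcases eq_or_ne x 0 with rfl | hx
    · simp
    have hx' : 0 < ‖x‖ := norm_pos_iff.2 hx
    have h1 : N z ≤ N (‖x‖⁻¹ • x) := hmin (by simp [norm_smul, hx'.ne'])
    rw [map_smul_eq_mul, norm_inv, norm_norm] at h1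
    rw [← div_eq_inv_mul, le_div_iff₀ hNz]
    rw [← div_eq_inv_mul, le_div_iff₀ hx'] at h1
    linarith
  · refine ⟨1, one_pos, fun x => ?_⟩
    by_contra hx
    have hx' : x ≠ 0 := by rintro rfl; simp at hx
    exact hd ⟨‖x‖⁻¹ • x, by simp [norm_smul, hx']⟩

variable {E}

lemma continuousOn_polarNorm_integrand (x : Fin d → ℝ) :
    ContinuousOn (fun t => N (matPow t E *ᵥ x) / t) (Set.Ioi 0) := by
  refine ContinuousOn.div ?_ continuousOn_id fun t ht => (ne_of_gt ht)
  refine (continuous_seminorm N).comp_continuousOn ?_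
  have h : ContinuousOn (fun t => flow E (Real.log t)) (Set.Ioi 0) :=
    (continuous_flow E).comp_continuousOn (Real.continuousOn_log.mono fun t ht => ne_of_gt ht)
  exact ((continuous_id.matrix_mulVec continuous_const).comp_continuousOn h :)

/-- `‖·‖_E` is equivalent to the supremum norm. From above, the contraction by `t ^ E` makes the
integral converge at `t = 0`; from below, the part of the integral over `[1/2, 1]` suffices. -/
lemma exists_polarNorm_bounds (hE : ∀ μ ∈ spectrum ℂ (E.map Complex.ofReal), 0 < μ.re)
    (hN : ∀ x, N x = 0 → x = 0) :
    ∃ C, 0 < C ∧ ∀ x, polarNorm E N x ≤ C * ‖x‖ ∧ ‖x‖ ≤ C * polarNorm E N x := by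
  obtain ⟨C₁, hC₁, h₁⟩ := exists_seminorm_le N
  obtain ⟨C₂, hC₂, h₂⟩ := exists_norm_le_seminorm N hN
  obtain ⟨C₃, δ, hC₃, hδ, h₃⟩ := exists_norm_flow_neg_mulVec_le E hE
  obtain ⟨κ, hκ, h₄⟩ := exists_norm_flow_mulVec_le E
  have hbound : ∀ x, ∀ t ∈ Set.Ioc (0 : ℝ) 1,
      ‖N (matPow t E *ᵥ x) / t‖ ≤ C₁ * C₃ * ‖x‖ * t ^ (δ - 1) := by
    rintro x t ⟨ht0, ht1⟩
    rw [norm_div, Real.norm_of_nonneg (apply_nonneg _ _), Real.norm_of_nonneg ht0.le,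
      Real.rpow_sub_one ht0.ne', ← mul_div_assoc]
    gcongr
    have h := h₃ (-Real.log t) (neg_nonneg.2 (Real.log_nonpos ht0.le ht1)) x
    rw [neg_neg, mul_neg, neg_neg, mul_comm δ, ← Real.rpow_def_of_pos ht0] at h
    calc N (matPow t E *ᵥ x) ≤ C₁ * ‖flow E (Real.log t) *ᵥ x‖ := h₁ _
      _ ≤ C₁ * (C₃ * t ^ δ * ‖x‖) := by gcongr
      _ = _ := by ring
  have hint' : ∀ x : Fin d → ℝ,
      IntervalIntegrable (fun t : ℝ => C₁ * C₃ * ‖x‖ * t ^ (δ - 1)) volume 0 1 :=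
    fun x => (intervalIntegral.intervalIntegrable_rpow' (by linarith)).const_mul _
  have hint : ∀ x, IntervalIntegrable (fun t => N (matPow t E *ᵥ x) / t) volume 0 1 := fun x => by
    refine (hint' x).mono_fun ?_ ?_
    · rw [Set.uIoc_of_le zero_le_one]
      exact ((continuousOn_polarNorm_integrand N x).mono fun t ht => ht.1).aestronglyMeasurable
        measurableSet_Ioc
    · rw [Set.uIoc_of_le zero_le_one]
      refine (ae_restrict_iff' measurableSet_Ioc).2 (Eventually.of_forall fun t ht => ?_)
      exact (hbound x t ht).trans (le_abs_self _)
  have hup : ∀ x, polarNorm E N x ≤ C₁ * C₃ * δ⁻¹ * ‖x‖ := fun x => by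
    calc polarNorm E N x ≤ ∫ t in (0 : ℝ)..1, C₁ * C₃ * ‖x‖ * t ^ (δ - 1) :=
          intervalIntegral.integral_mono_on_of_le_Ioo zero_le_one (hint x) (hint' x) fun t ht =>
            (le_abs_self _).trans (hbound x t ⟨ht.1, ht.2.le⟩)
      _ = _ := by
        rw [intervalIntegral.integral_const_mul, integral_rpow (Or.inl (by linarith))]
        rw [sub_add_cancel, Real.one_rpow, Real.zero_rpow hδ.ne']
        field_simp; ring
  set K := Real.exp (κ * Real.log 2) * C₂ with hK
  have hKpos : 0 < K := by positivity
  have hlow : ∀ x, ‖x‖ ≤ 2 * K * polarNorm E N x := fun x => by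
    have hsub : ∀ t ∈ Set.Icc (1 / 2 : ℝ) 1, K⁻¹ * ‖x‖ ≤ N (matPow t E *ᵥ x) / t := fun t ht => by
      have ht0 : 0 < t := by linarith [ht.1]
      have hlog : |(-Real.log t)| ≤ Real.log 2 := by
        rw [abs_neg, abs_of_nonpos (Real.log_nonpos ht0.le ht.2), ← Real.log_inv]
        exact Real.log_le_log (inv_pos.2 ht0) (by rw [inv_le_comm₀ ht0 two_pos]; linarith [ht.1])
      have h5 : ‖x‖ ≤ K * N (matPow t E *ᵥ x) := by
        calc ‖x‖ = ‖flow E (-Real.log t) *ᵥ (flow E (Real.log t) *ᵥ x)‖ := by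
              rw [flow_neg_mulVec_flow]
          _ ≤ Real.exp (κ * |(-Real.log t)|) * ‖flow E (Real.log t) *ᵥ x‖ := h₄ _ _
          _ ≤ Real.exp (κ * Real.log 2) * (C₂ * N (matPow t E *ᵥ x)) := by
              gcongr
              exact h₂ _
          _ = _ := by rw [hK]; ring
      rw [inv_mul_le_iff₀ hKpos]
      refine h5.trans ?_
      gcongr
      rw [le_div_iff₀ ht0]
      exact mul_le_of_le_one_right (apply_nonneg _ _) ht.2
    have h6 : ∫ t in (1 / 2 : ℝ)..1, K⁻¹ * ‖x‖ ≤ ∫ t in (1 / 2 : ℝ)..1, N (matPow t E *ᵥ x) / t :=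
      intervalIntegral.integral_mono_on (by norm_num) (by simp)
        ((hint x).mono_set (by
          rw [Set.uIcc_of_le (by norm_num), Set.uIcc_of_le (by norm_num)]
          exact Set.Icc_subset_Icc (by norm_num) le_rfl)) hsub
    have h7 : ∫ t in (1 / 2 : ℝ)..1, N (matPow t E *ᵥ x) / t ≤ polarNorm E N x :=
      intervalIntegral.integral_mono_interval (by norm_num) (by norm_num) le_rfl
        ((ae_restrict_iff' measurableSet_Ioc).2 (Eventually.of_forall fun t ht =>
          div_nonneg (apply_nonneg _ _) ht.1.le)) (hint x)
    rw [intervalIntegral.integral_const, smul_eq_mul] at h6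
    have h8 := h6.trans h7
    rw [show (1 - 1 / 2 : ℝ) * (K⁻¹ * ‖x‖) = ‖x‖ / (2 * K) by field_simp; norm_num,
      div_le_iff₀ (by positivity)] at h8
    linarith
  have hnn : ∀ x, 0 ≤ polarNorm E N x := fun x => by
    have := (norm_nonneg x).trans (hlow x)
    exact nonneg_of_mul_nonneg_right this (by positivity)
  refine ⟨max (C₁ * C₃ * δ⁻¹) (2 * K), lt_max_of_lt_right (by positivity), fun x => ⟨?_, ?_⟩⟩
  · exact (hup x).trans (by gcongr; exact le_max_left _ _)
  · exact (hlow x).trans (mul_le_mul_of_nonneg_right (le_max_right _ _) (hnn x))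

lemma radius_nonneg (x : Fin d → ℝ) : 0 ≤ radius E N x :=
  Real.sInf_nonneg fun _ ht => ht.1.le

lemma radius_le_exp {s : ℝ} {x : Fin d → ℝ} (h : polarNorm E N (flow E (-s) *ᵥ x) ≤ 1) :
    radius E N x ≤ Real.exp s :=
  csInf_le ⟨0, fun t ht => ht.1.le⟩
    ⟨Real.exp_pos _, by rwa [matPow_exp, flow_neg_left]⟩

/-- The radial part is small near the origin. -/
lemma exists_radius_le_exp (hE : ∀ μ ∈ spectrum ℂ (E.map Complex.ofReal), 0 < μ.re)
    (hN : ∀ x, N x = 0 → x = 0) (s : ℝ) :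
    ∃ r, 0 < r ∧ ∀ x, ‖x‖ ≤ r → radius E N x ≤ Real.exp s := by
  obtain ⟨C, hC, h⟩ := exists_polarNorm_bounds N hE hN
  obtain ⟨κ, -, h₄⟩ := exists_norm_flow_mulVec_le E
  refine ⟨(C * Real.exp (κ * |(-s)|))⁻¹, by positivity, fun x hx => radius_le_exp N ?_⟩
  calc _ ≤ C * (Real.exp (κ * |(-s)|) * ‖x‖) := (h _).1.trans (by gcongr; exact h₄ _ _)
    _ ≤ C * (Real.exp (κ * |(-s)|) * (C * Real.exp (κ * |(-s)|))⁻¹) := by gcongr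
    _ = 1 := by field_simp

lemma exists_polarNorm_flow_neg_le (hE : ∀ μ ∈ spectrum ℂ (E.map Complex.ofReal), 0 < μ.re)
    (hN : ∀ x, N x = 0 → x = 0) (r : ℝ) :
    ∃ s : ℝ, 0 ≤ s ∧ ∀ x, ‖x‖ ≤ r →
    polarNorm E N (flow E (-s) *ᵥ x) ≤ 1 := by
  obtain ⟨C, hC, h⟩ := exists_polarNorm_bounds N hE hN
  obtain ⟨C₃, δ, hC₃, hδ, h₃⟩ := exists_norm_flow_neg_mulVec_le E hE
  have ht : Tendsto (fun s => C * (C₃ * Real.exp (-(δ * s)) * r)) atTop (𝓝 (C * (C₃ * 0 * r))) := by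
    refine ((Tendsto.const_mul _ ?_).mul_const _).const_mul _
    exact Real.tendsto_exp_neg_atTop_nhds_zero.comp (tendsto_id.const_mul_atTop hδ)
  rw [mul_zero, zero_mul, mul_zero] at ht
  obtain ⟨s, hs1, hs2⟩ := ((ht.eventually_lt_const one_pos).and (eventually_ge_atTop 0)).exists
  refine ⟨s, hs2, fun x hx => ((h _).1.trans ?_).trans hs1.le⟩
  gcongr
  exact (h₃ s hs2 x).trans (by gcongr)

/-- The radial part is bounded on bounded sets. -/
lemma exists_radius_le (hE : ∀ μ ∈ spectrum ℂ (E.map Complex.ofReal), 0 < μ.re)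
    (hN : ∀ x, N x = 0 → x = 0) (r : ℝ) :
    ∃ T, 0 < T ∧ ∀ x, ‖x‖ ≤ r → radius E N x ≤ T := by
  obtain ⟨s, -, h⟩ := exists_polarNorm_flow_neg_le N hE hN r
  exact ⟨Real.exp s, Real.exp_pos _, fun x hx => radius_le_exp N (h x hx)⟩

/-- Vectors of radial part at most `e ^ (-s)` are moved by `e ^ (s E)` into a fixed ball. -/
lemma exists_norm_flow_le_of_radius_le (hE : ∀ μ ∈ spectrum ℂ (E.map Complex.ofReal), 0 < μ.re)
    (hN : ∀ x, N x = 0 → x = 0) :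
    ∃ R, 0 < R ∧ ∀ (s : ℝ) (x : Fin d → ℝ),
    radius E N x ≤ Real.exp (-s) → ‖flow E s *ᵥ x‖ ≤ R := by
  obtain ⟨C, hC, h⟩ := exists_polarNorm_bounds N hE hN
  obtain ⟨κ, hκ, h₄⟩ := exists_norm_flow_mulVec_le E
  obtain ⟨C₃, δ, hC₃, hδ, h₃⟩ := exists_norm_flow_neg_mulVec_le E hE
  refine ⟨Real.exp κ * (C₃ * C), by positivity, fun s x hx => ?_⟩
  have hne : {t : ℝ | 0 < t ∧ polarNorm E N (matPow t (-E) *ᵥ x) ≤ 1}.Nonempty := by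
    obtain ⟨u, -, hu⟩ := exists_polarNorm_flow_neg_le N hE hN ‖x‖
    exact ⟨Real.exp u, Real.exp_pos _, by rw [matPow_exp, flow_neg_left]; exact hu x le_rfl⟩
  have hlt : radius E N x < Real.exp (1 - s) :=
    hx.trans_lt (Real.exp_lt_exp.2 (by linarith))
  obtain ⟨t, ⟨ht0, ht⟩, hts⟩ := exists_lt_of_csInf_lt hne hlt
  have hlog : s + Real.log t ≤ 1 := by
    have := Real.log_lt_log ht0 hts
    rw [Real.log_exp] at this
    linarith
  rw [matPow_eq_flow, flow_neg_left] at ht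
  set z := flow E (-Real.log t) *ᵥ x with hz
  have hz1 : ‖z‖ ≤ C := (h z).2.trans (mul_le_of_le_one_right hC.le ht)
  have hx' : flow E s *ᵥ x = flow E 1 *ᵥ (flow E (-(1 - (s + Real.log t))) *ᵥ z) := by
    rw [hz, ← flow_mulVec_add, ← flow_mulVec_add]; congr 2; ring
  rw [hx']
  refine (h₄ _ _).trans ?_
  rw [abs_one, mul_one]
  gcongr
  refine (h₃ _ (by linarith) z).trans ?_
  have h5 : Real.exp (-(δ * (1 - (s + Real.log t)))) ≤ 1 :=
    Real.exp_le_one_iff.2 (neg_nonpos.2 (mul_nonneg hδ.le (by linarith)))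
  calc _ ≤ C₃ * 1 * C := by gcongr
    _ = _ := by ring

lemma radius_pos (hE : ∀ μ ∈ spectrum ℂ (E.map Complex.ofReal), 0 < μ.re)
    (hN : ∀ x, N x = 0 → x = 0) {x : Fin d → ℝ} (hx : x ≠ 0) : 0 < radius E N x := by
  refine lt_of_le_of_ne (radius_nonneg N x) fun h0 => hx ?_
  obtain ⟨R, hR, h⟩ := exists_norm_flow_le_of_radius_le N hE hN
  obtain ⟨C₃, δ, hC₃, hδ, h₃⟩ := exists_norm_flow_neg_mulVec_le E hE
  have ht : Tendsto (fun s => C₃ * Real.exp (-(δ * s)) * R) atTop (𝓝 (C₃ * 0 * R)) := by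
    refine (Tendsto.const_mul _ ?_).mul_const _
    exact Real.tendsto_exp_neg_atTop_nhds_zero.comp (tendsto_id.const_mul_atTop hδ)
  rw [mul_zero, zero_mul] at ht
  refine norm_le_zero_iff.1 (ge_of_tendsto ht ((eventually_ge_atTop 0).mono fun s hs => ?_))
  calc ‖x‖ = ‖flow E (-s) *ᵥ (flow E s *ᵥ x)‖ := by rw [flow_neg_mulVec_flow]
    _ ≤ C₃ * Real.exp (-(δ * s)) * ‖flow E s *ᵥ x‖ := h₃ s hs _
    _ ≤ _ := by gcongr; exact h s x (h0 ▸ (Real.exp_pos _).le)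

end Radius

/-! ### Integrals against Gaussian random measures -/

section Gaussian

variable {𝕜 : Type*} [RCLike 𝕜] {Ω : Type*} [MeasurableSpace Ω] {d m : ℕ} {P : Measure Ω}
  {M : Set (Fin d → ℝ) → Ω → (Fin m → 𝕜)}

lemma IsGaussianRandomMeasure.aemeasurable_re_dotProduct (hM : IsGaussianRandomMeasure P M)
    {A : Set (Fin d → ℝ)} (hA : MeasurableSet A) (hA' : volume A < ∞) (c : Fin m → 𝕜) :
    AEMeasurable (fun ω => RCLike.re (c ⬝ᵥ M A ω)) P := by
  have h := hM.aemeasurable A hA hA'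
  simp only [dotProduct]
  refine RCLike.measurable_re.comp_aemeasurable (Finset.aemeasurable_fun_sum _ fun k _ => ?_)
  exact ((measurable_pi_apply k).comp_aemeasurable h).const_mul _

/-- The characteristic function identifies the law of `re ⟨c, M A⟩` as a centred Gaussian; its
variance is `2 |A| ‖c‖²`, as the exponent `|A| ‖θ‖²` carries no factor `1/2`. -/
lemma IsGaussianRandomMeasure.mgf_re_dotProduct [IsProbabilityMeasure P]
    (hM : IsGaussianRandomMeasure P M)
    {A : Set (Fin d → ℝ)} (hA : MeasurableSet A) (hA' : volume A < ∞) (c : Fin m → 𝕜) (t : ℝ) :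
    mgf (fun ω => RCLike.re (c ⬝ᵥ M A ω)) P t =
      Real.exp (t ^ 2 * (volume.real A * ∑ k, ‖c k‖ ^ 2)) := by
  have hY := hM.aemeasurable_re_dotProduct hA hA' c
  obtain ⟨v, hv⟩ : ∃ v : NNReal, (v : ℝ) = 2 * (volume.real A * ∑ k, ‖c k‖ ^ 2) :=
    ⟨⟨_, by positivity⟩, rfl⟩
  have hmap : P.map (fun ω => RCLike.re (c ⬝ᵥ M A ω)) = gaussianReal 0 v := by
    have := Measure.isProbabilityMeasure_map hY
    refine Measure.ext_of_charFun (funext fun s => ?_)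
    rw [charFun_apply_real, charFun_gaussianReal, integral_map hY (by fun_prop)]
    have h := hM.charFun A hA hA' (fun k => (s : 𝕜) * star (c k))
    have h1 : ∀ ω, RCLike.re (star (fun k => (s : 𝕜) * star (c k)) ⬝ᵥ M A ω) =
        s * RCLike.re (c ⬝ᵥ M A ω) := by
      intro ω
      have : star (fun k => (s : 𝕜) * star (c k)) ⬝ᵥ M A ω = (s : 𝕜) * (c ⬝ᵥ M A ω) := by
        simp only [dotProduct, Pi.star_apply, star_mul', RCLike.star_def,
          RCLike.conj_ofReal, Finset.mul_sum]
        exact Finset.sum_congr rfl fun k _ => by simp; ring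
      rw [this, RCLike.re_ofReal_mul]
    simp only [h1] at h
    have h2 : ∑ k, ‖(s : 𝕜) * star (c k)‖ ^ 2 = s ^ 2 * ∑ k, ‖c k‖ ^ 2 := by
      rw [Finset.mul_sum]
      exact Finset.sum_congr rfl fun k _ => by simp [mul_pow]
    rw [h2] at h
    calc _ = ∫ ω, Complex.exp (Complex.I * ((s * RCLike.re (c ⬝ᵥ M A ω) : ℝ) : ℂ)) ∂P := by
          congr 1; funext ω; push_cast; ring_nf
      _ = _ := by
        rw [h, Complex.ofReal_exp]
        congr 1
        have hv' : ((v : ℝ) : ℂ) = _ := congrArg Complex.ofReal hv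
        rw [hv']
        push_cast
        ring
  rw [mgf_gaussianReal hmap]
  rw [hv]
  ring_nf

/-- The partial sums of the constant sequence `∅` converge, so that their increments tend to `0`. -/
lemma IsGaussianRandomMeasure.ae_empty (hM : IsGaussianRandomMeasure P M) :
    ∀ᵐ ω ∂P, M ∅ ω = 0 := by
  have h := hM.additive (fun _ => ∅) (fun _ => MeasurableSet.empty) (by simp)
    (fun _ _ _ => disjoint_bot_left)
  filter_upwards [h] with ω hω
  simp only [Set.iUnion_empty, Finset.sum_const, Finset.card_range] at hω
  have h2 := ((tendsto_add_atTop_iff_nat 1).2 hω).sub hω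
  simp only [add_smul, one_smul, add_sub_cancel_left, sub_self] at h2
  exact tendsto_nhds_unique tendsto_const_nhds h2

lemma IsGaussianRandomMeasure.ae_union (hM : IsGaussianRandomMeasure P M)
    {A B : Set (Fin d → ℝ)} (hA : MeasurableSet A) (hB : MeasurableSet B) (hA' : volume A < ∞)
    (hB' : volume B < ∞) (hAB : Disjoint A B) :
    ∀ᵐ ω ∂P, M (A ∪ B) ω = M A ω + M B ω := by
  set F : ℕ → Set (Fin d → ℝ) := fun k => if k = 0 then A else if k = 1 then B else ∅ with hF
  have hU : ⋃ k, F k = A ∪ B := by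
    ext x
    simp only [Set.mem_iUnion, Set.mem_union]
    constructor
    · rintro ⟨k, hk⟩
      by_cases h0 : k = 0
      · left; simpa [hF, h0] using hk
      · by_cases h1 : k = 1
        · right; simpa [hF, h1] using hk
        · simp [hF, h0, h1] at hk
    · rintro (h | h)
      · exact ⟨0, by simpa [hF] using h⟩
      · exact ⟨1, by simpa [hF] using h⟩
  have h := hM.additive F
    (fun k => by simp only [hF]; split_ifs <;> simp [hA, hB])
    (by rw [hU]; exact (measure_union_le _ _).trans_lt (ENNReal.add_lt_top.2 ⟨hA', hB'⟩))
    (fun a b hab => by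
      simp only [Function.onFun, hF]
      split_ifs <;> first | omega | simp [hAB.symm])
  filter_upwards [h, hM.ae_empty] with ω hω h0
  rw [hU] at hω
  refine tendsto_nhds_unique hω (tendsto_const_nhds.congr' ?_)
  filter_upwards [eventually_ge_atTop 2] with n hn
  obtain ⟨k, rfl⟩ := Nat.exists_eq_add_of_le hn
  rw [Finset.sum_range_add]
  have : ∀ x ∈ Finset.range k, M (F (2 + x)) ω = 0 := fun x _ => by
    simp only [hF]; rw [if_neg (by omega), if_neg (by omega), h0]
  rw [Finset.sum_eq_zero this, add_zero, Finset.sum_range_succ, Finset.sum_range_one]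
  simp [hF]

lemma IsGaussianRandomMeasure.ae_biUnion (hM : IsGaussianRandomMeasure P M) {ι : Type*}
    (A : ι → Set (Fin d → ℝ)) (hA : ∀ i, MeasurableSet (A i))
    (hd : Pairwise (Function.onFun Disjoint A)) (s : Finset ι) (hA' : ∀ i ∈ s, volume (A i) < ∞) :
    ∀ᵐ ω ∂P, M (⋃ i ∈ s, A i) ω = ∑ i ∈ s, M (A i) ω := by
  classical
  induction s using Finset.induction_on with
  | empty => simpa using hM.ae_empty
  | insert i s hi ih =>
    have h1 := ih fun j hj => hA' j (Finset.mem_insert_of_mem hj)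
    have h2 := hM.ae_union (hA i) (s.measurableSet_biUnion fun j _ => hA j)
      (hA' i (Finset.mem_insert_self _ _))
      ((measure_biUnion_lt_top s.finite_toSet fun j hj => hA' j (Finset.mem_insert_of_mem hj)))
      (Set.disjoint_iUnion₂_right.2 fun j hj => hd (by rintro rfl; exact hi hj))
    filter_upwards [h1, h2] with ω h1 h2
    rw [Finset.set_biUnion_insert, h2, h1, Finset.sum_insert hi]

/-- The integral of a simple function can be computed on a finer partition. -/
lemma IsGaussianRandomMeasure.simpleIntegral_map (hM : IsGaussianRandomMeasure P M) {β : Type*}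
    (g : SimpleFunc (Fin d → ℝ) β) (h : β → Matrix (Fin m) (Fin m) 𝕜)
    (hg : ∀ b, h b ≠ 0 → volume (g ⁻¹' {b}) < ∞) :
    ∀ᵐ ω ∂P, simpleIntegral M (g.map h) ω = ∑ b ∈ g.range, h b *ᵥ M (g ⁻¹' {b}) ω := by
  classical
  have key : ∀ c ∈ (g.map h).range, ∀ᵐ ω ∂P, c *ᵥ M ((g.map h) ⁻¹' {c}) ω =
      ∑ b ∈ g.range with h b = c, h b *ᵥ M (g ⁻¹' {b}) ω := by
    intro c _
    rcases eq_or_ne c 0 with rfl | hc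
    · refine Eventually.of_forall fun ω => ?_
      rw [zero_mulVec, Finset.sum_eq_zero]
      intro b hb
      rw [(Finset.mem_filter.1 hb).2, zero_mulVec]
    have h1 := hM.ae_biUnion (fun b => g ⁻¹' {b}) (fun b => g.measurableSet_preimage _)
      (fun a b hab => (Set.disjoint_singleton.2 hab).preimage g) (g.range.filter fun b => h b = c)
      (fun b hb => hg b (by rw [(Finset.mem_filter.1 hb).2]; exact hc))
    filter_upwards [h1] with ω hω
    have h2 : (g.map h) ⁻¹' {c} = ⋃ b ∈ (g.range.filter fun b => h b = c), g ⁻¹' {b} := by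
      ext x; simp
    rw [h2, hω, Matrix.mulVec_sum]
    exact Finset.sum_congr rfl fun b hb => by rw [(Finset.mem_filter.1 hb).2]
  have key' : ∀ᵐ ω ∂P, ∀ c ∈ (g.map h).range, c *ᵥ M ((g.map h) ⁻¹' {c}) ω =
      ∑ b ∈ g.range with h b = c, h b *ᵥ M (g ⁻¹' {b}) ω :=
    (ae_ball_iff (Finset.countable_toSet _)).2 key
  filter_upwards [key'] with ω hω
  rw [simpleIntegral, Finset.sum_congr rfl hω]
  refine Finset.sum_fiberwise_of_maps_to (fun b hb => ?_) _
  rw [SimpleFunc.range_map]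
  exact Finset.mem_image_of_mem h hb

/-- The independence over sequences of sets gives that over countable families, by filling up with
empty sets. -/
lemma IsGaussianRandomMeasure.iIndepFun_of_countable (hM : IsGaussianRandomMeasure P M) {ι : Type*}
    [Countable ι] (A : ι → Set (Fin d → ℝ)) (hA : ∀ i, MeasurableSet (A i))
    (hA' : ∀ i, volume (A i) < ∞) (hd : Pairwise (Function.onFun Disjoint A)) :
    iIndepFun (fun i => M (A i)) P := by
  obtain ⟨e, he⟩ := exists_injective_nat ι
  have hext : ∀ i, Function.extend e A (fun _ => ∅) (e i) = A i := he.extend_apply _ _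
  have h := hM.indep (Function.extend e A fun _ => ∅) (fun k => ?_) (fun k => ?_) ?_
  · have h' := h.precomp he
    simpa only [hext] using h'
  · by_cases hk : ∃ i, e i = k
    · obtain ⟨i, rfl⟩ := hk; rw [hext]; exact hA i
    · rw [Function.extend_apply' _ _ _ hk]; exact MeasurableSet.empty
  · by_cases hk : ∃ i, e i = k
    · obtain ⟨i, rfl⟩ := hk; rw [hext]; exact hA' i
    · rw [Function.extend_apply' _ _ _ hk]; simp
  · intro a b hab
    by_cases ha : ∃ i, e i = a
    · by_cases hb : ∃ i, e i = b
      · obtain ⟨i, rfl⟩ := ha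
        obtain ⟨j, rfl⟩ := hb
        simp only [Function.onFun, hext]
        exact hd fun h => hab (h ▸ rfl)
      · simp only [Function.onFun, Function.extend_apply' _ _ _ hb]; exact disjoint_bot_right
    · simp only [Function.onFun, Function.extend_apply' _ _ _ ha]; exact disjoint_bot_left

/-- Moment generating function of a coordinate of the integral of a simple function. -/
lemma IsGaussianRandomMeasure.mgf_sum [IsProbabilityMeasure P]
    (hM : IsGaussianRandomMeasure P M) {β : Type*}
    (g : SimpleFunc (Fin d → ℝ) β) (h : β → Matrix (Fin m) (Fin m) 𝕜)
    (hg : ∀ b, h b ≠ 0 → volume (g ⁻¹' {b}) < ∞) (j : Fin m) (t : ℝ) :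
    mgf (fun ω => RCLike.re ((∑ b ∈ g.range, h b *ᵥ M (g ⁻¹' {b}) ω) j)) P t =
      Real.exp (t ^ 2 * (∫⁻ y, ∑ k, ‖h (g y) j k‖ₑ ^ 2).toReal) := by
  classical
  set s := g.range.filter fun b => h b ≠ 0 with hs
  have hfin : ∀ i : s, volume (g ⁻¹' {(i : β)}) < ∞ := fun i => hg _ (Finset.mem_filter.1 i.2).2
  have hind := hM.iIndepFun_of_countable (fun i : s => g ⁻¹' {(i : β)})
    (fun i => g.measurableSet_preimage _) hfin
    (fun a b hab => (Set.disjoint_singleton.2 fun hc => hab (Subtype.ext hc)).preimage g)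
  have hind' := hind.comp (fun i : s => fun x : Fin m → 𝕜 => RCLike.re (h i j ⬝ᵥ x))
    (fun i => by simp only [dotProduct]; fun_prop)
  have h1 := hind'.mgf_sum₀ (t := t) (fun i => hM.aemeasurable_re_dotProduct
    (g.measurableSet_preimage _) (hfin i) (h i j)) Finset.univ
  have h2 : (fun ω => RCLike.re ((∑ b ∈ g.range, h b *ᵥ M (g ⁻¹' {b}) ω) j)) =
      ∑ i : s, (fun x : Fin m → 𝕜 => RCLike.re (h i j ⬝ᵥ x)) ∘ fun ω => M (g ⁻¹' {(i : β)}) ω := by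
    funext ω
    rw [Finset.sum_apply, Finset.sum_apply, map_sum, ← Finset.sum_filter_add_sum_filter_not g.range
      (fun b => h b ≠ 0), ← hs]
    have h3 : ∑ x ∈ g.range with ¬h x ≠ 0, RCLike.re ((h x *ᵥ M (g ⁻¹' {x}) ω) j) = 0 := by
      refine Finset.sum_eq_zero fun b hb => ?_
      rw [not_not.1 (Finset.mem_filter.1 hb).2]; simp
    rw [h3, add_zero, ← Finset.sum_coe_sort]
    rfl
  rw [h2]
  refine h1.trans ?_
  have h4 : ∀ i : s, mgf ((fun x : Fin m → 𝕜 => RCLike.re (h i j ⬝ᵥ x)) ∘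
      fun ω => M (g ⁻¹' {(i : β)}) ω) P t =
      Real.exp (t ^ 2 * (volume.real (g ⁻¹' {(i : β)}) * ∑ k, ‖h i j k‖ ^ 2)) := fun i =>
    hM.mgf_re_dotProduct (g.measurableSet_preimage _) (hfin i) (h i j) t
  rw [Finset.prod_congr rfl fun i _ => h4 i, ← Real.exp_sum, ← Finset.mul_sum]
  congr 2
  have h5 : ∫⁻ y, ∑ k, ‖h (g y) j k‖ₑ ^ 2 =
      ∑ b ∈ g.range, (∑ k, ‖h b j k‖ₑ ^ 2) * volume (g ⁻¹' {b}) := by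
    rw [← SimpleFunc.map_lintegral]
    exact (SimpleFunc.lintegral_eq_lintegral (g.map fun b => ∑ k, ‖h b j k‖ₑ ^ 2) volume)
  have h6 : ∑ b ∈ g.range, (∑ k, ‖h b j k‖ₑ ^ 2) * volume (g ⁻¹' {b}) =
      ∑ b ∈ s, (∑ k, ‖h b j k‖ₑ ^ 2) * volume (g ⁻¹' {b}) := by
    rw [hs, Finset.sum_filter]
    refine Finset.sum_congr rfl fun b _ => ?_
    split_ifs with hb
    · rfl
    · rw [not_not.1 hb]; simp
  rw [h5, h6, ENNReal.toReal_sum]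
  · refine Eq.trans ?_ (Finset.sum_coe_sort s fun b =>
      ((∑ k, ‖h b j k‖ₑ ^ 2) * volume (g ⁻¹' {b})).toReal)
    refine Finset.sum_congr rfl fun i _ => ?_
    rw [ENNReal.toReal_mul, ENNReal.toReal_sum (fun k _ => by finiteness), mul_comm]
    simp [Measure.real]
  · intro b hb
    have := hg b (Finset.mem_filter.1 hb).2
    exact ENNReal.mul_ne_top (ENNReal.sum_ne_top.2 fun k _ => by finiteness) this.ne

lemma enorm_add_add_sq_le (x y z : 𝕜) :
    ‖x + y + z‖ₑ ^ 2 ≤ 3 * (‖x‖ₑ ^ 2 + ‖y‖ₑ ^ 2 + ‖z‖ₑ ^ 2) := by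
  have h : ‖x + y + z‖ ^ 2 ≤ 3 * (‖x‖ ^ 2 + ‖y‖ ^ 2 + ‖z‖ ^ 2) := by
    calc ‖x + y + z‖ ^ 2 ≤ (‖x‖ + ‖y‖ + ‖z‖) ^ 2 := by gcongr; exact norm_add₃_le
      _ ≤ _ := by
        nlinarith [sq_nonneg (‖x‖ - ‖y‖), sq_nonneg (‖y‖ - ‖z‖), sq_nonneg (‖x‖ - ‖z‖)]
  have h' := ENNReal.ofReal_le_ofReal h
  rw [ENNReal.ofReal_mul (by norm_num), ENNReal.ofReal_add (by positivity) (by positivity),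
    ENNReal.ofReal_add (by positivity) (by positivity), ENNReal.ofReal_pow (norm_nonneg _),
    ENNReal.ofReal_pow (norm_nonneg _), ENNReal.ofReal_pow (norm_nonneg _),
    ENNReal.ofReal_pow (norm_nonneg _)] at h'
  simpa only [ofReal_norm, ENNReal.ofReal_ofNat] using h'

/-- Only kernels that are square integrable have a stochastic integral. -/
lemma IsStochasticIntegral.lintegral_lt_top {Q : (Fin d → ℝ) → Matrix (Fin m) (Fin m) 𝕜}
    {Z : Ω → (Fin m → 𝕜)} (hZ : IsStochasticIntegral P M Q Z) :
    ∫⁻ y, ∑ i, ∑ j, ‖Q y i j‖ₑ ^ 2 < ∞ := by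
  obtain ⟨f, hf, hlim, -⟩ := hZ
  obtain ⟨n, hn⟩ := (hlim.eventually_lt_const one_pos).exists
  have h1 : ∫⁻ y, ∑ i, ∑ j, ‖f n y i j‖ₑ ^ 2 < ∞ := by
    have h2 : ((f n).map fun A : Matrix (Fin m) (Fin m) 𝕜 =>
        ∑ i, ∑ j, ‖A i j‖ₑ ^ 2).FinMeasSupp volume := (hf n).map (by simp)
    have h3 := h2.lintegral_lt_top (Eventually.of_forall fun y => by
      simp only [SimpleFunc.map_apply]
      exact ENNReal.sum_ne_top.2 fun i _ => ENNReal.sum_ne_top.2 fun j _ => by finiteness)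
    rw [← SimpleFunc.lintegral_eq_lintegral] at h3
    exact h3
  have hmeas : Measurable fun y => ∑ i, ∑ j, ‖f n y i j‖ₑ ^ 2 :=
    ((f n).map fun A : Matrix (Fin m) (Fin m) 𝕜 => ∑ i, ∑ j, ‖A i j‖ₑ ^ 2).measurable
  calc ∫⁻ y, ∑ i, ∑ j, ‖Q y i j‖ₑ ^ 2
      ≤ ∫⁻ y, (3 * ∑ i, ∑ j, ‖f n y i j‖ₑ ^ 2 + 3 * ∑ i, ∑ j, ‖f n y i j - Q y i j‖ₑ ^ 2) := by
        refine lintegral_mono fun y => ?_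
        simp only [Finset.mul_sum, ← Finset.sum_add_distrib]
        refine Finset.sum_le_sum fun i _ => Finset.sum_le_sum fun j _ => ?_
        have := enorm_add_add_sq_le (f n y i j) (-(f n y i j - Q y i j)) 0
        rw [enorm_neg] at this
        simpa [mul_add] using this
    _ = 3 * (∫⁻ y, ∑ i, ∑ j, ‖f n y i j‖ₑ ^ 2) +
        3 * (∫⁻ y, ∑ i, ∑ j, ‖f n y i j - Q y i j‖ₑ ^ 2) := by
        rw [lintegral_add_left (hmeas.const_mul _), lintegral_const_mul' _ _ (by simp),
          lintegral_const_mul' _ _ (by simp)]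
    _ < ∞ := ENNReal.add_lt_top.2 ⟨ENNReal.mul_lt_top (by finiteness) h1,
        ENNReal.mul_lt_top (by finiteness) (hn.trans ENNReal.one_lt_top)⟩

lemma aemeasurable_simpleIntegral_apply (hM : IsGaussianRandomMeasure P M)
    (f : SimpleFunc (Fin d → ℝ) (Matrix (Fin m) (Fin m) 𝕜)) (hf : f.FinMeasSupp volume)
    (j : Fin m) : AEMeasurable (fun ω => RCLike.re (simpleIntegral M f ω j)) P := by
  simp only [simpleIntegral, Finset.sum_apply, map_sum]
  refine Finset.aemeasurable_fun_sum _ fun c _ => ?_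
  rcases eq_or_ne c 0 with rfl | hc
  · simp
  · exact hM.aemeasurable_re_dotProduct (f.measurableSet_preimage _)
      (hf.meas_preimage_singleton_ne_zero hc) (c j)

/-- Moment generating function of the difference of the integrals of two simple functions. -/
lemma IsGaussianRandomMeasure.lintegral_exp_simpleIntegral_sub [IsProbabilityMeasure P]
    (hM : IsGaussianRandomMeasure P M) (f f' : SimpleFunc (Fin d → ℝ) (Matrix (Fin m) (Fin m) 𝕜))
    (hf : f.FinMeasSupp volume) (hf' : f'.FinMeasSupp volume) (j : Fin m) (t : ℝ) :
    ∫⁻ ω, ENNReal.ofReal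
        (Real.exp (t * RCLike.re (simpleIntegral M f ω j - simpleIntegral M f' ω j))) ∂P
      = ENNReal.ofReal (Real.exp (t ^ 2 * (∫⁻ y, ∑ k, ‖f y j k - f' y j k‖ₑ ^ 2).toReal)) := by
  have hpair := hf.pair hf'
  have hfin : ∀ b : Matrix (Fin m) (Fin m) 𝕜 × Matrix (Fin m) (Fin m) 𝕜, b ≠ 0 →
      volume ((f.pair f') ⁻¹' {b}) < ∞ := fun b hb =>
    hpair.meas_preimage_singleton_ne_zero hb
  have h1 := hM.simpleIntegral_map (f.pair f') Prod.fst
    (fun b hb => hfin b fun hc => hb (by rw [hc]; rfl))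
  have h2 := hM.simpleIntegral_map (f.pair f') Prod.snd
    (fun b hb => hfin b fun hc => hb (by rw [hc]; rfl))
  have h3 := hM.mgf_sum (f.pair f') (fun b => b.1 - b.2)
    (fun b hb => hfin b fun hc => hb (by rw [hc]; simp)) j t
  have h4 : (fun ω => RCLike.re (simpleIntegral M f ω j - simpleIntegral M f' ω j)) =ᵐ[P]
      fun ω => RCLike.re ((∑ b ∈ (f.pair f').range,
        (b.1 - b.2) *ᵥ M ((f.pair f') ⁻¹' {b}) ω) j) := by
    filter_upwards [h1, h2] with ω h1 h2
    have e1 : (f.pair f').map Prod.fst = f := by ext; rfl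
    have e2 : (f.pair f').map Prod.snd = f' := by ext; rfl
    rw [e1] at h1
    rw [e2] at h2
    rw [h1, h2, ← Pi.sub_apply, ← Finset.sum_sub_distrib]
    simp only [Matrix.sub_mulVec]
  rw [← mgf_congr h4] at h3
  rw [← ofReal_integral_eq_lintegral_ofReal]
  · exact congrArg ENNReal.ofReal h3
  · rw [← mgf_pos_iff, h3]
    exact Real.exp_pos _
  · exact Eventually.of_forall fun ω => (Real.exp_pos _).le

variable {Q Q' : (Fin d → ℝ) → Matrix (Fin m) (Fin m) 𝕜} {Z Z' : Ω → (Fin m → 𝕜)}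

/-- Stochastic integrals have subgaussian differences; this is the limit of the previous formula,
by Fatou's lemma. -/
lemma lintegral_exp_stochasticIntegral_sub_le [IsProbabilityMeasure P]
    (hM : IsGaussianRandomMeasure P M) (hZ : IsStochasticIntegral P M Q Z)
    (hZ' : IsStochasticIntegral P M Q' Z') (hQ : ∀ i j, Measurable fun y => Q y i j)
    (hQ' : ∀ i j, Measurable fun y => Q' y i j) (j : Fin m) {v : ℝ}
    (hv : ∫⁻ y, ∑ k, ‖Q y j k - Q' y j k‖ₑ ^ 2 < ENNReal.ofReal v) :
    AEMeasurable (fun ω => RCLike.re (Z ω j - Z' ω j)) P ∧ ∀ t : ℝ,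
    ∫⁻ ω, ENNReal.ofReal (Real.exp (t * RCLike.re (Z ω j - Z' ω j))) ∂P ≤
      ENNReal.ofReal (Real.exp (3 * v * t ^ 2)) := by
  have hv0 : 0 < v := ENNReal.ofReal_pos.1 (bot_le.trans_lt hv)
  obtain ⟨f, hf, hlim, hconv⟩ := hZ
  obtain ⟨f', hf', hlim', hconv'⟩ := hZ'
  -- a common subsequence along which both approximations converge almost surely
  obtain ⟨ns, hns, hae⟩ := hconv.exists_seq_tendsto_ae
  have hconv'' : TendstoInMeasure P (fun n => simpleIntegral M (f' (ns n))) atTop Z' :=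
    fun ε hε => (hconv' ε hε).comp hns.tendsto_atTop
  obtain ⟨ms, hms, hae'⟩ := hconv''.exists_seq_tendsto_ae
  set u : ℕ → ℕ := fun n => ns (ms n) with hu
  have hutop : Tendsto u atTop atTop := hns.tendsto_atTop.comp hms.tendsto_atTop
  set S : ℕ → Ω → ℝ := fun n ω =>
    RCLike.re (simpleIntegral M (f (u n)) ω j - simpleIntegral M (f' (u n)) ω j) with hS
  have hSm : ∀ n, AEMeasurable (S n) P := fun n => by
    simp only [hS, map_sub]
    exact (aemeasurable_simpleIntegral_apply hM _ (hf _) j).sub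
      (aemeasurable_simpleIntegral_apply hM _ (hf' _) j)
  have hSlim : ∀ᵐ ω ∂P, Tendsto (fun n => S n ω) atTop (𝓝 (RCLike.re (Z ω j - Z' ω j))) := by
    filter_upwards [hae, hae'] with ω h1 h2
    have h1' := (tendsto_pi_nhds.1 (h1.comp hms.tendsto_atTop)) j
    have h2' := (tendsto_pi_nhds.1 h2) j
    exact (RCLike.continuous_re.tendsto _).comp (h1'.sub h2')
  refine ⟨aemeasurable_of_tendsto_metrizable_ae _ hSm hSlim, fun t => ?_⟩
  -- the factor `3` comes from splitting `f - f'` at `Q` and `Q'`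
  have hev : ∀ᶠ n in atTop, ∫⁻ y, ∑ k, ‖f (u n) y j k - f' (u n) y j k‖ₑ ^ 2 ≤
      ENNReal.ofReal (3 * v) := by
    have hlimsum := (((hlim.comp hutop).add_const
      (∫⁻ y, ∑ k, ‖Q y j k - Q' y j k‖ₑ ^ 2)).add (hlim'.comp hutop))
    rw [zero_add, add_zero] at hlimsum
    filter_upwards [hlimsum.eventually_lt_const hv] with n hn
    have hfm : ∀ i k, Measurable fun y => f (u n) y i k := fun i k =>
      ((f (u n)).map fun A : Matrix (Fin m) (Fin m) 𝕜 => A i k).measurable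
    calc ∫⁻ y, ∑ k, ‖f (u n) y j k - f' (u n) y j k‖ₑ ^ 2
        ≤ ∫⁻ y, 3 * (∑ i, ∑ k, ‖f (u n) y i k - Q y i k‖ₑ ^ 2 + ∑ k, ‖Q y j k - Q' y j k‖ₑ ^ 2
            + ∑ i, ∑ k, ‖f' (u n) y i k - Q' y i k‖ₑ ^ 2) := by
          refine lintegral_mono fun y => ?_
          have hrow : ∀ F : Fin m → Fin m → ℝ≥0∞, ∑ k, F j k ≤ ∑ i, ∑ k, F i k := fun F =>
            Finset.single_le_sum (f := fun i => ∑ k, F i k) (fun _ _ => zero_le) (Finset.mem_univ j)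
          refine le_trans ?_ (mul_le_mul_right (add_le_add (add_le_add
            (hrow fun i k => ‖f (u n) y i k - Q y i k‖ₑ ^ 2) le_rfl)
            (hrow fun i k => ‖f' (u n) y i k - Q' y i k‖ₑ ^ 2)) _)
          rw [← Finset.sum_add_distrib, ← Finset.sum_add_distrib, Finset.mul_sum]
          refine Finset.sum_le_sum fun k _ => ?_
          have := enorm_add_add_sq_le (f (u n) y j k - Q y j k) (Q y j k - Q' y j k)
            (-(f' (u n) y j k - Q' y j k))
          rw [enorm_neg] at this
          refine le_trans (le_of_eq ?_) this
          congr 2; ring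
      _ = 3 * ((∫⁻ y, ∑ i, ∑ k, ‖f (u n) y i k - Q y i k‖ₑ ^ 2) +
            (∫⁻ y, ∑ k, ‖Q y j k - Q' y j k‖ₑ ^ 2) +
            (∫⁻ y, ∑ i, ∑ k, ‖f' (u n) y i k - Q' y i k‖ₑ ^ 2)) := by
          rw [lintegral_const_mul' _ _ (by simp), lintegral_add_left, lintegral_add_left]
          · fun_prop
          · fun_prop
      _ ≤ ENNReal.ofReal (3 * v) := by
          rw [ENNReal.ofReal_mul (by norm_num), ENNReal.ofReal_ofNat]
          gcongr
          exact hn.le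
  calc ∫⁻ ω, ENNReal.ofReal (Real.exp (t * RCLike.re (Z ω j - Z' ω j))) ∂P
      = ∫⁻ ω, liminf (fun n => ENNReal.ofReal (Real.exp (t * S n ω))) atTop ∂P := by
        refine lintegral_congr_ae ?_
        filter_upwards [hSlim] with ω hω
        refine (Tendsto.liminf_eq ?_).symm
        exact ENNReal.tendsto_ofReal ((Real.continuous_exp.tendsto _).comp (hω.const_mul t))
    _ ≤ liminf (fun n => ∫⁻ ω, ENNReal.ofReal (Real.exp (t * S n ω)) ∂P) atTop :=
        lintegral_liminf_le' fun n => (((hSm n).const_mul t).exp).ennreal_ofReal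
    _ ≤ ENNReal.ofReal (Real.exp (3 * v * t ^ 2)) := by
        refine liminf_le_of_frequently_le' (Eventually.frequently (hev.mono fun n hn => ?_))
        rw [hM.lintegral_exp_simpleIntegral_sub _ _ (hf _) (hf' _)]
        refine ENNReal.ofReal_le_ofReal (Real.exp_le_exp.2 ?_)
        rw [mul_comm]
        gcongr
        exact ENNReal.toReal_le_of_le_ofReal (by positivity) hn

/-- A variable `Y` with `E exp (t Y) ≤ exp (v t²)` has Gaussian tails. -/
lemma measure_le_abs_le_of_lintegral_exp_le {Y : Ω → ℝ} (hY : AEMeasurable Y P) {v : ℝ} (hv : 0 < v)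
    (h : ∀ t : ℝ,
      ∫⁻ ω, ENNReal.ofReal (Real.exp (t * Y ω)) ∂P ≤ ENNReal.ofReal (Real.exp (v * t ^ 2)))
    {a : ℝ} (ha : 0 ≤ a) :
    P {ω | a ≤ |Y ω|} ≤ ENNReal.ofReal (2 * Real.exp (-(a ^ 2 / (4 * v)))) := by
  have key : ∀ σ : ℝ, σ ^ 2 = 1 →
      P {ω | a ≤ σ * Y ω} ≤ ENNReal.ofReal (Real.exp (-(a ^ 2 / (4 * v)))) := by
    intro σ hσ
    -- the optimal parameter in Chernoff's bound
    set t := a / (2 * v) with ht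
    have ht0 : 0 ≤ t := by positivity
    have h1 : {ω | a ≤ σ * Y ω} ⊆ {ω | ENNReal.ofReal (Real.exp (t * a)) ≤
        ENNReal.ofReal (Real.exp ((σ * t) * Y ω))} := by
      intro ω hω
      refine ENNReal.ofReal_le_ofReal (Real.exp_le_exp.2 ?_)
      calc t * a ≤ t * (σ * Y ω) := mul_le_mul_of_nonneg_left hω ht0
        _ = _ := by ring
    have h2 := mul_meas_ge_le_lintegral₀ (μ := P)
      (((hY.const_mul (σ * t)).exp).ennreal_ofReal) (ENNReal.ofReal (Real.exp (t * a)))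
    have h3 := (h2.trans (h (σ * t)))
    have h4 : P {ω | a ≤ σ * Y ω} ≤ ENNReal.ofReal (Real.exp (v * (σ * t) ^ 2)) /
        ENNReal.ofReal (Real.exp (t * a)) := by
      rw [ENNReal.le_div_iff_mul_le (Or.inl (by simp [Real.exp_pos])) (Or.inl (by simp)), mul_comm]
      exact (mul_le_mul_right (measure_mono h1) _).trans h3
    refine h4.trans (le_of_eq ?_)
    rw [← ENNReal.ofReal_div_of_pos (Real.exp_pos _), ← Real.exp_sub]
    congr 2
    rw [mul_pow, hσ, ht]
    field_simp
    ring
  have hsub : {ω | a ≤ |Y ω|} ⊆ {ω | a ≤ 1 * Y ω} ∪ {ω | a ≤ -1 * Y ω} := by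
    intro ω hω
    rcases le_abs.1 (show a ≤ |Y ω| from hω) with h | h
    · left; simpa using h
    · right; simpa using h
  calc _ ≤ _ := measure_mono hsub
    _ ≤ _ := measure_union_le _ _
    _ ≤ _ := add_le_add (key 1 (by norm_num)) (key (-1) (by norm_num))
    _ = _ := by rw [← ENNReal.ofReal_add (by positivity) (by positivity)]; ring_nf

/-- Gaussian tails of the differences of stochastic integrals. -/
lemma measure_le_abs_stochasticIntegral_sub_le [IsProbabilityMeasure P]
    (hM : IsGaussianRandomMeasure P M) (hZ : IsStochasticIntegral P M Q Z)
    (hZ' : IsStochasticIntegral P M Q' Z') (hQ : ∀ i j, Measurable fun y => Q y i j)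
    (hQ' : ∀ i j, Measurable fun y => Q' y i j) (j : Fin m) {v : ℝ}
    (hv : ∫⁻ y, ∑ k, ‖Q y j k - Q' y j k‖ₑ ^ 2 < ENNReal.ofReal v) {a : ℝ} (ha : 0 ≤ a) :
    P {ω | a ≤ |RCLike.re (Z ω j) - RCLike.re (Z' ω j)|} ≤
      ENNReal.ofReal (2 * Real.exp (-(a ^ 2 / (12 * v)))) := by
  have hv0 : 0 < v := ENNReal.ofReal_pos.1 (bot_le.trans_lt hv)
  obtain ⟨h1, h2⟩ := lintegral_exp_stochasticIntegral_sub_le hM hZ hZ' hQ hQ' j hv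
  have h3 := measure_le_abs_le_of_lintegral_exp_le h1 (v := 3 * v) (by positivity) h2 ha
  simp only [map_sub] at h3
  rwa [← mul_assoc, show (4 * 3 : ℝ) = 12 by norm_num] at h3

end Gaussian

/-! ### Chaining along anisotropic grids -/

/-- The size `(n + 1) ^ (p - 1/2) e ^ (-l n)` of the increments on the scale `e ^ (-n)`. -/
def chainWeight (l : ℝ) (p n : ℕ) : ℝ :=
  ((n : ℝ) + 1) ^ ((p : ℝ) - 1 / 2) * Real.exp (-(l * n))

section Weight

variable {l : ℝ} {p : ℕ}

lemma chainWeight_pos (l : ℝ) (p n : ℕ) : 0 < chainWeight l p n := by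
  rw [chainWeight]; positivity

lemma chainWeight_add_le (hp : 1 ≤ p) (n k : ℕ) :
    chainWeight l p (n + k) ≤ chainWeight l p n * chainWeight l p k := by
  have hp' : (1 : ℝ) ≤ p := by exact_mod_cast hp
  have h1 : (((n + k : ℕ) : ℝ) + 1) ^ ((p : ℝ) - 1 / 2) ≤
      ((n : ℝ) + 1) ^ ((p : ℝ) - 1 / 2) * ((k : ℝ) + 1) ^ ((p : ℝ) - 1 / 2) := by
    rw [← Real.mul_rpow (by positivity) (by positivity)]
    refine Real.rpow_le_rpow (by positivity) ?_ (by linarith)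
    push_cast
    nlinarith [mul_nonneg (Nat.cast_nonneg (α := ℝ) n) (Nat.cast_nonneg (α := ℝ) k)]
  have h2 : Real.exp (-(l * (n + k : ℕ))) = Real.exp (-(l * n)) * Real.exp (-(l * k)) := by
    rw [← Real.exp_add]; congr 1; push_cast; ring
  rw [chainWeight, chainWeight, chainWeight, h2]
  calc _ ≤ (((n : ℝ) + 1) ^ ((p : ℝ) - 1 / 2) * ((k : ℝ) + 1) ^ ((p : ℝ) - 1 / 2)) *
        (Real.exp (-(l * n)) * Real.exp (-(l * k))) := by gcongr
    _ = _ := by ring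

lemma summable_chainWeight (hl : 0 < l) (p : ℕ) : Summable (chainWeight l p) := by
  have h1 := (summable_nat_add_iff 1).2 (Real.summable_pow_mul_exp_neg_nat_mul p hl)
  refine Summable.of_nonneg_of_le (fun n => (chainWeight_pos l p n).le) (fun n => ?_)
    (h1.mul_left (Real.exp l))
  have h2 : Real.exp (-(l * n)) = Real.exp l * Real.exp (-l * ((n + 1 : ℕ) : ℝ)) := by
    rw [← Real.exp_add]; congr 1; push_cast; ring
  have h3 : ((n : ℝ) + 1) ^ ((p : ℝ) - 1 / 2) ≤ ((n + 1 : ℕ) : ℝ) ^ p := by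
    rw [← Real.rpow_natCast]
    push_cast
    exact Real.rpow_le_rpow_of_exponent_le (by linarith [Nat.cast_nonneg (α := ℝ) n]) (by linarith)
  rw [chainWeight, h2]
  calc _ ≤ ((n + 1 : ℕ) : ℝ) ^ p * (Real.exp l * Real.exp (-l * ((n + 1 : ℕ) : ℝ))) := by gcongr
    _ = _ := by ring

lemma chainWeight_sq (hp : 1 ≤ p) (n : ℕ) : chainWeight l p n ^ 2 =
    ((n : ℝ) + 1) * (Real.exp (-(l * n)) * ((n : ℝ) + 1) ^ (p - 1)) ^ 2 := by
  have h : (((n : ℝ) + 1) ^ ((p : ℝ) - 1 / 2)) ^ 2 =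
      ((n : ℝ) + 1) * (((n : ℝ) + 1) ^ (p - 1)) ^ 2 := by
    rw [← Real.rpow_natCast, ← Real.rpow_mul (by positivity), ← pow_mul, ← pow_succ',
      ← Real.rpow_natCast _ ((p - 1) * 2 + 1)]
    congr 1
    push_cast [Nat.cast_sub hp]
    ring
  rw [chainWeight, mul_pow, h]
  ring

end Weight

section Limit

/-- A sequence of approximations whose successive differences are controlled by `chainWeight`
converges, with an error of the order of the first difference. -/
lemma exists_tendsto_of_chainWeight {l : ℝ} (hl : 0 < l) {p : ℕ} (hp : 1 ≤ p) {b : ℝ} (hb : 0 ≤ b)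
    {a : ℕ → ℝ} {n₀ : ℕ} (h : ∀ n, n₀ ≤ n → |a n - a (n + 1)| ≤ b * chainWeight l p n) :
    ∃ A, Tendsto a atTop (𝓝 A) ∧
      ∀ n, n₀ ≤ n → |a n - A| ≤ b * (∑' k, chainWeight l p k) * chainWeight l p n := by
  have hs := summable_chainWeight hl p
  have hshift : ∀ n, n₀ ≤ n → ∀ k, dist (a (n + k)) (a (n + k + 1)) ≤
      b * chainWeight l p n * chainWeight l p k := fun n hn k => by
    rw [Real.dist_eq, mul_assoc]
    exact (h (n + k) (by omega)).trans (by gcongr; exact chainWeight_add_le hp n k)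
  have hc := cauchySeq_of_dist_le_of_summable (f := fun k => a (n₀ + k)) _ (hshift n₀ le_rfl)
    (hs.mul_left _)
  obtain ⟨A, hA⟩ := cauchySeq_tendsto_of_complete hc
  have hA' : Tendsto a atTop (𝓝 A) := by
    simp only [add_comm n₀] at hA
    exact (tendsto_add_atTop_iff_nat n₀).1 hA
  refine ⟨A, hA', fun n hn => ?_⟩
  have h1 : Tendsto (fun k => a (n + k)) atTop (𝓝 A) := by
    simp only [add_comm n]
    exact (tendsto_add_atTop_iff_nat n).2 hA'
  have h2 := dist_le_tsum_of_dist_le_of_tendsto₀ _ (hshift n hn) (hs.mul_left _) h1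
  rw [tsum_mul_left, Real.dist_eq, add_zero] at h2
  refine h2.trans (le_of_eq (by ring))

end Limit

section Modulus

variable {d : ℕ} {E : Matrix (Fin d) (Fin d) ℝ} {N : Seminorm ℝ (Fin d → ℝ)}

/-- The scale `e ^ (-n)` of the radial part of a vector. -/
lemma exists_scale {τ : ℝ} (hτ : 0 < τ) {n₀ : ℕ} (h : τ ≤ Real.exp (-(n₀ + 1 : ℝ))) :
    ∃ n : ℕ, n₀ + 1 ≤ n ∧ (n : ℝ) ≤ Real.log (1 / τ) ∧ Real.log (1 / τ) < n + 1 ∧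
      τ ≤ Real.exp (-(n : ℝ)) := by
  have h1 : (n₀ + 1 : ℝ) ≤ Real.log (1 / τ) := by
    rw [one_div, Real.log_inv, le_neg]
    rw [← Real.log_exp (-(n₀ + 1 : ℝ))]
    exact Real.log_le_log hτ h
  have h2 : (0 : ℝ) ≤ Real.log (1 / τ) := le_trans (by positivity) h1
  refine ⟨⌊Real.log (1 / τ)⌋₊, Nat.le_floor (by push_cast; exact h1), Nat.floor_le h2,
    Nat.lt_floor_add_one _, ?_⟩
  have h3 := Nat.floor_le h2
  rw [← Real.log_le_iff_le_exp hτ]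
  rw [one_div, Real.log_inv] at h3 ⊢
  linarith

variable {l c R : ℝ} {p n₀ : ℕ} {g : (Fin d → ℝ) → ℝ}

/-- Increments bounded by `chainWeight` on the scale `‖e ^ (n E) (x - y)‖ ≤ R` give continuity. -/
lemma continuousOn_of_chainWeight (hl : 0 < l) (hR : 0 < R)
    (hg : ∀ n, n₀ ≤ n → ∀ x ∈ Set.Icc (0 : Fin d → ℝ) 1, ∀ y ∈ Set.Icc (0 : Fin d → ℝ) 1,
      ‖flow E n *ᵥ (x - y)‖ ≤ R → |g x - g y| ≤ c * chainWeight l p n) :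
    ContinuousOn g (Set.Icc 0 1) := by
  intro x hx
  rw [ContinuousWithinAt, Metric.tendsto_nhds]
  intro ε hε
  have h1 : Tendsto (fun n => c * chainWeight l p n) atTop (𝓝 (c * 0)) :=
    (summable_chainWeight hl p).tendsto_atTop_zero.const_mul c
  rw [mul_zero] at h1
  obtain ⟨n, hn1, hn2⟩ := ((h1.eventually_lt_const hε).and (eventually_ge_atTop n₀)).exists
  have h2 : ContinuousAt (fun y : Fin d → ℝ => ‖flow E n *ᵥ (y - x)‖) x := by
    have : Continuous fun y : Fin d → ℝ => ‖flow E n *ᵥ (y - x)‖ :=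
      (continuous_const.matrix_mulVec (continuous_id.sub continuous_const)).norm
    exact this.continuousAt
  have h3 : ∀ᶠ y in 𝓝 x, ‖flow E n *ᵥ (y - x)‖ < R :=
    h2.eventually_lt_const (by simpa using hR)
  filter_upwards [mem_nhdsWithin_of_mem_nhds h3, self_mem_nhdsWithin] with y hy hy'
  rw [Real.dist_eq]
  exact (hg n hn2 y hy' x hx hy.le).trans_lt hn1

/-- A pair with `τ(x - y) ≈ e ^ (-s)` belongs to the scale `n = ⌊s⌋`, whose `chainWeight` is at most
`2 ^ (p - 1/2) e ^ l` times the modulus of continuity at `τ(x - y)`. -/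
lemma modulusLimsup_le_of_chainWeight (hE : ∀ μ ∈ spectrum ℂ (E.map Complex.ofReal), 0 < μ.re)
    (hN : ∀ x, N x = 0 → x = 0) (hl : 0 < l) (hp : 1 ≤ p) (hc : 0 ≤ c)
    (hR : ∀ (s : ℝ) (x : Fin d → ℝ), radius E N x ≤ Real.exp (-s) → ‖flow E s *ᵥ x‖ ≤ R)
    (hg : ∀ n, n₀ ≤ n → ∀ x ∈ Set.Icc (0 : Fin d → ℝ) 1, ∀ y ∈ Set.Icc (0 : Fin d → ℝ) 1,
      ‖flow E n *ᵥ (x - y)‖ ≤ R → |g x - g y| ≤ c * chainWeight l p n) :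
    modulusLimsup (radius E N) l p g ≤
      ENNReal.ofReal (c * (2 ^ ((p : ℝ) - 1 / 2) * Real.exp l)) := by
  have hp' : (1 : ℝ) ≤ p := by exact_mod_cast hp
  refine limsup_le_of_le (by isBoundedDefault) ?_
  filter_upwards [Ioc_mem_nhdsGT (Real.exp_pos (-(n₀ + 1 : ℝ)))] with r hr
  refine iSup₂_le fun x hx => iSup₂_le fun y hy => iSup_le fun hxy => ENNReal.ofReal_le_ofReal ?_
  have hτ := radius_pos N hE hN (sub_ne_zero.2 hxy.1)
  set τ := radius E N (x - y) with hτdef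
  obtain ⟨n, hn1, hn2, hn3, hn4⟩ := exists_scale hτ (hxy.2.trans hr.2)
  have h1 := hg n (by omega) x hx y hy (hR n _ hn4)
  have hn0 : (1 : ℝ) ≤ n := by exact_mod_cast (by omega : 1 ≤ n)
  set s := Real.log (1 / τ) with hs
  have hτs : τ = Real.exp (-s) := by rw [hs, one_div, Real.log_inv, neg_neg, Real.exp_log hτ]
  have hs0 : 0 < s := by linarith
  rw [div_le_iff₀ (by positivity)]
  refine h1.trans ?_
  have h2 : ((n : ℝ) + 1) ^ ((p : ℝ) - 1 / 2) ≤ 2 ^ ((p : ℝ) - 1 / 2) * s ^ ((p : ℝ) - 1 / 2) := by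
    rw [← Real.mul_rpow two_pos.le hs0.le]
    exact Real.rpow_le_rpow (by positivity) (by linarith) (by linarith)
  have h3 : Real.exp (-(l * n)) ≤ Real.exp l * τ ^ l := by
    rw [hτs, ← Real.exp_mul, ← Real.exp_add]
    exact Real.exp_le_exp.2 (by nlinarith)
  calc c * chainWeight l p n ≤ c * ((2 ^ ((p : ℝ) - 1 / 2) * s ^ ((p : ℝ) - 1 / 2)) *
        (Real.exp l * τ ^ l)) := by rw [chainWeight]; gcongr
    _ = _ := by ring

/-- The Hölder bound on the whole cube: on fine scales `ε` absorbs the powers of `n`, and pairs at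
larger distance are handled by the boundedness of `g`. The exponent `l - ε` may be negative. -/
lemma exists_holder_of_chainWeight (hE : ∀ μ ∈ spectrum ℂ (E.map Complex.ofReal), 0 < μ.re)
    (hN : ∀ x, N x = 0 → x = 0) (hl : 0 < l) (hc : 0 ≤ c) (hR0 : 0 < R)
    (hR : ∀ (s : ℝ) (x : Fin d → ℝ), radius E N x ≤ Real.exp (-s) → ‖flow E s *ᵥ x‖ ≤ R)
    (hg : ∀ n, n₀ ≤ n → ∀ x ∈ Set.Icc (0 : Fin d → ℝ) 1, ∀ y ∈ Set.Icc (0 : Fin d → ℝ) 1,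
      ‖flow E n *ᵥ (x - y)‖ ≤ R → |g x - g y| ≤ c * chainWeight l p n) {ε : ℝ} (hε : 0 < ε) :
    ∃ K, 0 ≤ K ∧ ∀ x ∈ Set.Icc (0 : Fin d → ℝ) 1, ∀ y ∈ Set.Icc (0 : Fin d → ℝ) 1,
      |g x - g y| ≤ K * radius E N (x - y) ^ (l - ε) := by
  have hcont := continuousOn_of_chainWeight (E := E) (p := p) hl hR0 hg
  obtain ⟨G, hG⟩ := (isCompact_Icc.image_of_continuousOn hcont).isBounded.exists_norm_le
  have hG' : ∀ x ∈ Set.Icc (0 : Fin d → ℝ) 1, |g x| ≤ G := fun x hx => hG _ ⟨x, hx, rfl⟩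
  have hG0 : 0 ≤ G := (abs_nonneg _).trans (hG' 0 ⟨le_rfl, zero_le_one⟩)
  obtain ⟨T, hT, hT'⟩ := exists_radius_le N hE hN 1
  set r := Real.exp (-(n₀ + 1 : ℝ)) with hr
  have hr0 : 0 < r := Real.exp_pos _
  -- `K₁` serves the pairs of radial distance larger than `r`, `K₂` those on the finer scales
  set θ := min (r ^ (l - ε)) (T ^ (l - ε)) with hθ
  have hθ0 : 0 < θ := lt_min (Real.rpow_pos_of_pos hr0 _) (Real.rpow_pos_of_pos hT _)
  set S := ∑' k, chainWeight ε p k with hS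
  have hS0 : 0 ≤ S := tsum_nonneg fun k => (chainWeight_pos ε p k).le
  set K₁ := 2 * G / θ with hK₁
  set K₂ := c * (S * Real.exp |l - ε|) with hK₂
  refine ⟨K₁ + K₂, by positivity, fun x hx y hy => ?_⟩
  rcases eq_or_ne x y with rfl | hxy
  · rw [sub_self, abs_zero]
    exact mul_nonneg (by positivity) (Real.rpow_nonneg (radius_nonneg N _) _)
  have hτ := radius_pos N hE hN (sub_ne_zero.2 hxy)
  set τ := radius E N (x - y) with hτdef
  have hτl : 0 < τ ^ (l - ε) := Real.rpow_pos_of_pos hτ _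
  rcases le_total τ r with hτr | hτr
  · obtain ⟨n, hn1, hn2, hn3, hn4⟩ := exists_scale hτ hτr
    have h1 := hg n (by omega) x hx y hy (hR n _ hn4)
    set s := Real.log (1 / τ) with hs
    have hτs : τ = Real.exp (-s) := by rw [hs, one_div, Real.log_inv, neg_neg, Real.exp_log hτ]
    have h2 : chainWeight l p n = chainWeight ε p n * Real.exp (-((l - ε) * n)) := by
      rw [chainWeight, chainWeight, mul_assoc, ← Real.exp_add]; congr 2; ring
    have h3 : Real.exp (-((l - ε) * n)) ≤ Real.exp |l - ε| * τ ^ (l - ε) := by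
      rw [hτs, ← Real.exp_mul, ← Real.exp_add]
      refine Real.exp_le_exp.2 ?_
      have h5 : (l - ε) * (s - n) ≤ |l - ε| * 1 := by
        refine (le_abs_self _).trans ?_
        rw [abs_mul]
        gcongr
        rw [abs_le]; constructor <;> linarith
      linarith
    have h4 : chainWeight ε p n ≤ S :=
      (summable_chainWeight hε p).le_tsum n fun k _ => (chainWeight_pos ε p k).le
    calc |g x - g y| ≤ c * (S * (Real.exp |l - ε| * τ ^ (l - ε))) := by
          refine h1.trans ?_
          rw [h2]
          gcongr
      _ = K₂ * τ ^ (l - ε) := by rw [hK₂]; ring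
      _ ≤ _ := by
        gcongr
        have : 0 ≤ K₁ := by positivity
        linarith
  · have hτT : τ ≤ T := hT' _ ((pi_norm_le_iff_of_nonneg zero_le_one).2 fun i => by
      rw [Pi.sub_apply, Real.norm_eq_abs, abs_le]
      have h1 := hx.1 i; have h2 := hx.2 i; have h3 := hy.1 i; have h4 := hy.2 i
      simp only [Pi.zero_apply, Pi.one_apply] at h1 h2 h3 h4
      constructor <;> linarith)
    have hθτ : θ ≤ τ ^ (l - ε) := by
      rcases le_total 0 (l - ε) with h | h
      · exact (min_le_left _ _).trans (Real.rpow_le_rpow hr0.le hτr h)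
      · exact (min_le_right _ _).trans (Real.rpow_le_rpow_of_nonpos hτ hτT h)
    calc |g x - g y| ≤ |g x| + |g y| := abs_sub _ _
      _ ≤ 2 * G := by linarith [hG' x hx, hG' y hy]
      _ = K₁ * θ := by rw [hK₁]; field_simp
      _ ≤ K₁ * τ ^ (l - ε) := by gcongr
      _ ≤ _ := by
        gcongr
        have : 0 ≤ K₂ := by positivity
        linarith

end Modulus

section Grid

variable {d : ℕ} (E : Matrix (Fin d) (Fin d) ℝ)

/-- The point of the anisotropic grid `e ^ (-n E) ℤ^d` below `x`. -/
def gridPoint (n : ℕ) (x : Fin d → ℝ) : Fin d → ℝ :=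
  flow E (-n) *ᵥ fun i => (⌊(flow E n *ᵥ x) i⌋ : ℝ)

lemma norm_flow_gridPoint_sub_le (n : ℕ) (x : Fin d → ℝ) :
    ‖flow E n *ᵥ (gridPoint E n x - x)‖ ≤ 1 := by
  rw [Matrix.mulVec_sub, gridPoint, flow_mulVec_flow_neg, pi_norm_le_iff_of_nonneg zero_le_one]
  intro i
  rw [Pi.sub_apply, Real.norm_eq_abs, abs_sub_comm, Int.self_sub_floor, Int.abs_fract]
  exact (Int.fract_lt_one _).le

lemma norm_le_one_of_mem_Icc {x : Fin d → ℝ} (hx : x ∈ Set.Icc (0 : Fin d → ℝ) 1) : ‖x‖ ≤ 1 :=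
  (pi_norm_le_iff_of_nonneg zero_le_one).2 fun i => by
    rw [Real.norm_eq_abs, abs_of_nonneg (hx.1 i)]
    exact hx.2 i

/-- The unit cube meets at most exponentially many cells of the grids. -/
lemma exists_finset_gridPoint : ∃ A κ : ℝ, 0 ≤ A ∧ 0 ≤ κ ∧ ∀ n : ℕ, ∃ G : Finset (Fin d → ℝ),
    (∀ x ∈ Set.Icc (0 : Fin d → ℝ) 1, gridPoint E n x ∈ G) ∧
    (G.card : ℝ) ≤ A * Real.exp (κ * n) := by
  classical
  obtain ⟨κ, hκ, h⟩ := exists_norm_flow_mulVec_le E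
  refine ⟨7 ^ d, d * κ, by positivity, by positivity, fun n => ?_⟩
  set L : ℕ := ⌈Real.exp (κ * n)⌉₊ + 1 with hL
  refine ⟨(Fintype.piFinset fun _ => Finset.Icc (-(L : ℤ)) L).image
    fun z : Fin d → ℤ => flow E (-n) *ᵥ fun i => (z i : ℝ), fun x hx => ?_, ?_⟩
  · refine Finset.mem_image.2 ⟨fun i => ⌊(flow E n *ᵥ x) i⌋,
      Fintype.mem_piFinset.2 fun i => ?_, rfl⟩
    have h1 : |(flow E n *ᵥ x) i| ≤ Real.exp (κ * n) := by
      refine (norm_le_pi_norm (flow E n *ᵥ x) i).trans ((h n x).trans ?_)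
      rw [Nat.abs_cast]
      exact mul_le_of_le_one_right (Real.exp_pos _).le (norm_le_one_of_mem_Icc hx)
    have h2 := Nat.le_ceil (Real.exp (κ * n))
    rw [abs_le] at h1
    rw [Finset.mem_Icc, Int.le_floor]
    constructor
    · rw [hL]; push_cast; linarith
    · have h3 := Int.floor_le ((flow E n *ᵥ x) i)
      have : ((⌊(flow E n *ᵥ x) i⌋ : ℤ) : ℝ) ≤ ((L : ℤ) : ℝ) := by
        rw [hL]; push_cast; linarith
      exact_mod_cast this
  · have h1 : ((Fintype.piFinset fun _ : Fin d => Finset.Icc (-(L : ℤ)) L).card : ℝ) =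
        (2 * L + 1) ^ d := by
      rw [Fintype.card_piFinset_const, Int.card_Icc]
      have : ((L : ℤ) + 1 - -(L : ℤ)).toNat = 2 * L + 1 := by omega
      rw [this]; push_cast; rfl
    refine (Nat.cast_le.2 Finset.card_image_le).trans ?_
    rw [h1, mul_assoc, Real.exp_nat_mul, ← mul_pow]
    have h2 := Nat.ceil_lt_add_one (Real.exp_pos (κ * n)).le
    have h3 : 1 ≤ Real.exp (κ * n) := Real.one_le_exp (by positivity)
    gcongr
    rw [hL]; push_cast; linarith

end Grid

section Chaining

variable {Ω : Type*} [MeasurableSpace Ω] {P : Measure Ω} {d : ℕ} {E : Matrix (Fin d) (Fin d) ℝ}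
  {F : (Fin d → ℝ) → Ω → ℝ} {l : ℝ} {p : ℕ} {B R : ℝ}

/-- Borel–Cantelli for exponentially many increments on each scale. -/
lemma ae_eventually_forall_lt_chainWeight (hp : 1 ≤ p) (hB : 0 < B)
    (hF : ∀ (n : ℕ) (u v : Fin d → ℝ), ‖flow E n *ᵥ (u - v)‖ ≤ R → ∀ a : ℝ, 0 ≤ a →
      P {ω | a ≤ |F u ω - F v ω|} ≤ ENNReal.ofReal (2 * Real.exp
        (-(a ^ 2 / (B * (Real.exp (-(l * n)) * ((n : ℝ) + 1) ^ (p - 1)) ^ 2)))))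
    {A κ : ℝ} (hA : 0 ≤ A) (hκ : 0 ≤ κ) (S : ℕ → Finset ((Fin d → ℝ) × (Fin d → ℝ)))
    (hcard : ∀ n, ((S n).card : ℝ) ≤ A * Real.exp (κ * n))
    (hS : ∀ n, ∀ q ∈ S n, ‖flow E n *ᵥ (q.1 - q.2)‖ ≤ R) :
    ∀ᵐ ω ∂P, ∀ᶠ n in atTop, ∀ q ∈ S n,
      |F q.1 ω - F q.2 ω| < Real.sqrt (B * (κ + 1)) * chainWeight l p n := by
  -- `b² = B (κ + 1)` makes each probability at most `2 e ^ (-(κ + 1) (n + 1))`, which beats the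
  -- number `A e ^ (κ n)` of pairs
  set b := Real.sqrt (B * (κ + 1)) with hb
  have hb2 : b ^ 2 = B * (κ + 1) := Real.sq_sqrt (by positivity)
  have hb0 : 0 ≤ b := Real.sqrt_nonneg _
  set bad : ℕ → Set Ω := fun n => ⋃ q ∈ S n, {ω | b * chainWeight l p n ≤ |F q.1 ω - F q.2 ω|}
    with hbad
  have hbound : ∀ n, P (bad n) ≤ ENNReal.ofReal (2 * A * Real.exp (-(1 : ℝ) * n)) := by
    intro n
    have h1 : ∀ q ∈ S n, P {ω | b * chainWeight l p n ≤ |F q.1 ω - F q.2 ω|} ≤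
        ENNReal.ofReal (2 * Real.exp (-((κ + 1) * (n + 1)))) := by
      intro q hq
      refine (hF n q.1 q.2 (hS n q hq) _ (mul_nonneg hb0 (chainWeight_pos l p n).le)).trans
        (le_of_eq ?_)
      rw [mul_pow, chainWeight_sq hp, hb2]
      congr 4
      have := Real.exp_pos (-(l * n))
      field_simp
    calc P (bad n) ≤ ∑ q ∈ S n, P {ω | b * chainWeight l p n ≤ |F q.1 ω - F q.2 ω|} :=
          measure_biUnion_finset_le _ _
      _ ≤ ∑ q ∈ S n, ENNReal.ofReal (2 * Real.exp (-((κ + 1) * (n + 1)))) := Finset.sum_le_sum h1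
      _ = ENNReal.ofReal ((S n).card * (2 * Real.exp (-((κ + 1) * (n + 1))))) := by
          rw [Finset.sum_const, nsmul_eq_mul,
            ENNReal.ofReal_mul (p := ((S n).card : ℝ)) (by positivity), ENNReal.ofReal_natCast]
      _ ≤ _ := by
          refine ENNReal.ofReal_le_ofReal ?_
          calc _ ≤ (A * Real.exp (κ * n)) * (2 * Real.exp (-((κ + 1) * (n + 1)))) := by
                gcongr; exact hcard n
            _ = 2 * A * Real.exp (κ * n + -((κ + 1) * (n + 1))) := by rw [Real.exp_add]; ring
            _ ≤ _ := by
                gcongr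
                nlinarith
  have hsum : ∑' n, P (bad n) ≠ ∞ := by
    have hs : Summable fun n : ℕ => 2 * A * Real.exp (-(1 : ℝ) * n) := by
      have := (Real.summable_pow_mul_exp_neg_nat_mul 0 one_pos).mul_left (2 * A)
      simpa using this
    exact ((ENNReal.tsum_le_tsum hbound).trans_lt hs.tsum_ofReal_lt_top).ne
  filter_upwards [ae_eventually_notMem hsum] with ω hω
  filter_upwards [hω] with n hn q hq
  by_contra! hc
  exact hn (Set.mem_biUnion hq hc)

/-- The chaining argument: almost surely, the values on the grids converge, and the limit has
increments controlled by `chainWeight`. -/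
lemma exists_ae_chain (hl : 0 < l) (hp : 1 ≤ p) {R₀ : ℝ} (hR₀ : 0 ≤ R₀) :
    ∃ R, R₀ ≤ R ∧ ∀ B, 0 < B → ∃ c, 0 ≤ c ∧
    ∀ {Ω : Type*} [MeasurableSpace Ω] (P : Measure Ω) (F : (Fin d → ℝ) → Ω → ℝ),
    (∀ (n : ℕ) (u v : Fin d → ℝ), ‖flow E n *ᵥ (u - v)‖ ≤ R → ∀ a : ℝ, 0 ≤ a →
      P {ω | a ≤ |F u ω - F v ω|} ≤ ENNReal.ofReal (2 * Real.exp
        (-(a ^ 2 / (B * (Real.exp (-(l * n)) * ((n : ℝ) + 1) ^ (p - 1)) ^ 2))))) →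
    (∀ x, ∀ᵐ ω ∂P, Tendsto (fun n => F (gridPoint E n x) ω) atTop (𝓝 (F x ω))) ∧
    ∀ᵐ ω ∂P, ∃ n₀ : ℕ, ∀ n, n₀ ≤ n → ∀ x ∈ Set.Icc (0 : Fin d → ℝ) 1,
      ∀ y ∈ Set.Icc (0 : Fin d → ℝ) 1, ‖flow E n *ᵥ (x - y)‖ ≤ R₀ →
        |limUnder atTop (fun k => F (gridPoint E k x) ω) -
          limUnder atTop (fun k => F (gridPoint E k y) ω)| ≤ c * chainWeight l p n := by
  classical
  obtain ⟨A, κ, hA, hκ, hG⟩ := exists_finset_gridPoint E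
  choose G hG1 hG2 using hG
  obtain ⟨κ', hκ', hflow⟩ := exists_norm_flow_mulVec_le E
  -- grid neighbours of points at distance `R₀`, and of one point on consecutive scales, are
  -- within `R` of each other
  set R := R₀ + 2 + Real.exp κ' with hR
  have hexp := Real.exp_pos κ'
  refine ⟨R, by linarith, fun B hB => ?_⟩
  set b := Real.sqrt (B * (2 * κ + 1)) with hb
  have hb0 : 0 ≤ b := Real.sqrt_nonneg _
  set s := ∑' k, chainWeight l p k with hs
  have hs0 : 0 ≤ s := tsum_nonneg fun k => (chainWeight_pos l p k).le
  refine ⟨b * (2 * s + 1), by positivity, fun {Ω} _ P F hF => ⟨fun x => ?_, ?_⟩⟩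
  · have h := ae_eventually_forall_lt_chainWeight hp hB hF (A := 1) (κ := 2 * κ) zero_le_one
      (by positivity) (fun n => {(gridPoint E n x, x)})
      (fun n => by
        rw [Finset.card_singleton, one_mul, Nat.cast_one]
        exact Real.one_le_exp (by positivity))
      (fun n q hq => by
        rw [Finset.mem_singleton.1 hq]
        exact (norm_flow_gridPoint_sub_le E n x).trans (by linarith))
    have ht : Tendsto (fun n => b * chainWeight l p n) atTop (𝓝 0) := by
      simpa using (summable_chainWeight hl p).tendsto_atTop_zero.const_mul b
    filter_upwards [h] with ω hω
    rw [tendsto_iff_dist_tendsto_zero]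
    refine squeeze_zero' (Eventually.of_forall fun n => dist_nonneg) (hω.mono fun n hn => ?_) ht
    rw [Real.dist_eq]
    exact (hn _ (Finset.mem_singleton_self _)).le
  · set S : ℕ → Finset ((Fin d → ℝ) × (Fin d → ℝ)) := fun n =>
      (G n ×ˢ (G n ∪ G (n + 1))).filter fun q => ‖flow E n *ᵥ (q.1 - q.2)‖ ≤ R with hS
    have hcard : ∀ n, ((S n).card : ℝ) ≤ A * (A + A * Real.exp κ) * Real.exp (2 * κ * n) := by
      intro n
      have h1 : (S n).card ≤ (G n).card * ((G n).card + (G (n + 1)).card) :=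
        (Finset.card_filter_le _ _).trans (by
          rw [Finset.card_product]; gcongr; exact Finset.card_union_le _ _)
      calc ((S n).card : ℝ) ≤ (G n).card * ((G n).card + (G (n + 1)).card) := by exact_mod_cast h1
        _ ≤ (A * Real.exp (κ * n)) * (A * Real.exp (κ * n) + A * Real.exp (κ * (n + 1 : ℕ))) := by
            gcongr <;> exact hG2 _
        _ = _ := by
            have e1 : Real.exp (κ * (n + 1 : ℕ)) = Real.exp κ * Real.exp (κ * n) := by
              rw [← Real.exp_add]; congr 1; push_cast; ring
            have e2 : Real.exp (2 * κ * n) = Real.exp (κ * n) * Real.exp (κ * n) := by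
              rw [← Real.exp_add]; congr 1; ring
            rw [e1, e2]; ring
    have h := ae_eventually_forall_lt_chainWeight hp hB hF (κ := 2 * κ) (by positivity)
      (by positivity) S hcard (fun n q hq => (Finset.mem_filter.1 hq).2)
    filter_upwards [h] with ω hω
    obtain ⟨n₀, hn₀⟩ := eventually_atTop.1 hω
    have hmem : ∀ n, ∀ x ∈ Set.Icc (0 : Fin d → ℝ) 1, n₀ ≤ n →
        |F (gridPoint E n x) ω - F (gridPoint E (n + 1) x) ω| ≤ b * chainWeight l p n := by
      intro n x hx hn
      refine (hn₀ n hn (gridPoint E n x, gridPoint E (n + 1) x) (Finset.mem_filter.2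
        ⟨Finset.mem_product.2 ⟨hG1 n x hx, Finset.mem_union_right _ (hG1 (n + 1) x hx)⟩, ?_⟩)).le
      have e1 : flow E n *ᵥ (gridPoint E n x - gridPoint E (n + 1) x) =
          flow E n *ᵥ (gridPoint E n x - x) -
            flow E (-1) *ᵥ (flow E (n + 1 : ℕ) *ᵥ (gridPoint E (n + 1) x - x)) := by
        rw [← flow_mulVec_add, ← sub_sub_sub_cancel_right _ _ x, Matrix.mulVec_sub]
        congr 3
        push_cast; ring
      have h1 := norm_flow_gridPoint_sub_le E n x
      have h2 := hflow (-1) (flow E (n + 1 : ℕ) *ᵥ (gridPoint E (n + 1) x - x))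
      rw [abs_neg, abs_one, mul_one] at h2
      have h3 := h2.trans (mul_le_of_le_one_right hexp.le (norm_flow_gridPoint_sub_le E (n + 1) x))
      dsimp only
      rw [e1]
      exact (norm_sub_le _ _).trans (by linarith)
    refine ⟨n₀, fun n hn x hx y hy hxy => ?_⟩
    obtain ⟨a, ha, ha'⟩ := exists_tendsto_of_chainWeight hl hp hb0 fun n hn => hmem n x hx hn
    obtain ⟨a₂, hy2, hy2'⟩ := exists_tendsto_of_chainWeight hl hp hb0 fun n hn => hmem n y hy hn
    rw [ha.limUnder_eq, hy2.limUnder_eq]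
    have h1 : |F (gridPoint E n x) ω - F (gridPoint E n y) ω| ≤ b * chainWeight l p n := by
      refine (hn₀ n hn (gridPoint E n x, gridPoint E n y) (Finset.mem_filter.2
        ⟨Finset.mem_product.2 ⟨hG1 n x hx, Finset.mem_union_left _ (hG1 n y hy)⟩, ?_⟩)).le
      have e1 : flow E n *ᵥ (gridPoint E n x - gridPoint E n y) =
          flow E n *ᵥ (gridPoint E n x - x) + flow E n *ᵥ (x - y) -
            flow E n *ᵥ (gridPoint E n y - y) := by
        rw [← Matrix.mulVec_add, ← Matrix.mulVec_sub]; congr 1; abel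
      dsimp only
      rw [e1]
      have h1 := norm_flow_gridPoint_sub_le E n x
      have h2 := norm_flow_gridPoint_sub_le E n y
      refine (norm_sub_le _ _).trans ((add_le_add_left (norm_add_le _ _) _).trans (by linarith))
    have h2 := ha' n hn
    have h3 := hy2' n hn
    rw [abs_le] at h1 h2 h3 ⊢
    constructor <;> nlinarith

end Chaining

/-! ### Moduli of continuity of continuous modifications -/

section Modification

variable {d m : ℕ} {E : Matrix (Fin d) (Fin d) ℝ} {N : Seminorm ℝ (Fin d → ℝ)}

/-- Two modifications with continuous paths agree on the cube, simultaneously for all points. -/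
lemma IsContinuousModification.ae_eqOn {Ω : Type*} [MeasurableSpace Ω] {P : Measure Ω}
    {X Y Y' : (Fin d → ℝ) → Ω → (Fin m → ℝ)} (hY : IsContinuousModification P X Y)
    (hY' : IsContinuousModification P X Y') :
    ∀ᵐ ω ∂P, ∀ x ∈ Set.Icc (0 : Fin d → ℝ) 1, Y x ω = Y' x ω := by
  obtain ⟨t, hts, htc, ht⟩ := (TopologicalSpace.IsSeparable.of_separableSpace
    (Set.Icc (0 : Fin d → ℝ) 1)).exists_countable_dense_subset
  have h : ∀ᵐ ω ∂P, ∀ x ∈ t, Y x ω = Y' x ω :=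
    (ae_ball_iff htc).2 fun x _ => (hY.1 x).trans (hY'.1 x).symm
  filter_upwards [h, hY.2, hY'.2] with ω h h1 h2
  exact Set.EqOn.of_subset_closure (fun x hx => h x hx) h1 h2 hts ht

/-- A field whose increments have Gaussian tails of the order `τ ^ λ |log τ| ^ (p - 1)` has the
modulus of continuity `τ ^ λ |log τ| ^ (p - 1/2)`. -/
theorem exists_hasModulusOfContinuity (hE : ∀ μ ∈ spectrum ℂ (E.map Complex.ofReal), 0 < μ.re)
    (hN : ∀ x, N x = 0 → x = 0) {lam : Fin m → ℝ} (hlam : ∀ j, 0 < lam j) {p : Fin m → ℕ}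
    (hp : ∀ j, 1 ≤ p j) :
    ∃ R, 0 < R ∧ ∀ B, 0 < B → ∃ C, 0 < C ∧
      ∀ (Ω : Type*) [MeasurableSpace Ω] (P : Measure Ω) (X : (Fin d → ℝ) → Ω → (Fin m → ℝ)),
      (∀ (j : Fin m) (n : ℕ) (u v : Fin d → ℝ), ‖flow E n *ᵥ (u - v)‖ ≤ R → ∀ a : ℝ, 0 ≤ a →
        P {ω | a ≤ |X u ω j - X v ω j|} ≤ ENNReal.ofReal (2 * Real.exp
          (-(a ^ 2 / (B * (Real.exp (-(lam j * n)) * ((n : ℝ) + 1) ^ (p j - 1)) ^ 2))))) →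
      HasModulusOfContinuity P (radius E N) lam p C X := by
  classical
  obtain ⟨R₀, hR₀, hrad⟩ := exists_norm_flow_le_of_radius_le N hE hN
  choose R hR hchain using fun j => exists_ae_chain (E := E) (hlam j) (hp j) hR₀.le
  have hRle : ∀ j, R j ≤ R₀ + ∑ i, R i := fun j => by
    have := Finset.single_le_sum (f := R) (fun i _ => hR₀.le.trans (hR i)) (Finset.mem_univ j)
    linarith
  have hRsum : 0 ≤ ∑ i, R i := Finset.sum_nonneg fun i _ => hR₀.le.trans (hR i)
  refine ⟨R₀ + ∑ i, R i, by positivity, fun B hB => ?_⟩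
  choose c hc hchain using fun j => hchain j B hB
  have hcnn : ∀ j, 0 ≤ c j * (2 ^ ((p j : ℝ) - 1 / 2) * Real.exp (lam j)) := fun j => by
    have := hc j
    positivity
  refine ⟨1 + ∑ j, c j * (2 ^ ((p j : ℝ) - 1 / 2) * Real.exp (lam j)), by
    have := Finset.sum_nonneg fun j (_ : j ∈ Finset.univ) => hcnn j
    positivity, fun Ω _ P X htail => ?_⟩
  have hpt := fun j => (hchain j P (fun x ω => X x ω j)
    fun n u v huv => htail j n u v (huv.trans (hRle j))).1
  have hosc := fun j => (hchain j P (fun x ω => X x ω j)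
    fun n u v huv => htail j n u v (huv.trans (hRle j))).2
  -- the modification is the limit along the grids on the cube, and `X` itself elsewhere
  set Y : (Fin d → ℝ) → Ω → (Fin m → ℝ) := fun x ω j =>
    if x ∈ Set.Icc (0 : Fin d → ℝ) 1 then limUnder atTop (fun k => X (gridPoint E k x) ω j)
    else X x ω j with hY
  have hYosc : ∀ᵐ ω ∂P, ∀ j, ∃ n₀ : ℕ, ∀ n, n₀ ≤ n → ∀ x ∈ Set.Icc (0 : Fin d → ℝ) 1,
      ∀ y ∈ Set.Icc (0 : Fin d → ℝ) 1, ‖flow E n *ᵥ (x - y)‖ ≤ R₀ →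
        |Y x ω j - Y y ω j| ≤ c j * chainWeight (lam j) (p j) n := by
    filter_upwards [ae_all_iff.2 hosc] with ω hω j
    obtain ⟨n₀, h⟩ := hω j
    refine ⟨n₀, fun n hn x hx y hy hxy => ?_⟩
    simp only [hY, if_pos hx, if_pos hy]
    exact h n hn x hx y hy hxy
  have hYmod : IsContinuousModification P X Y := by
    refine ⟨fun x => ?_, ?_⟩
    · filter_upwards [ae_all_iff.2 fun j => hpt j x] with ω hω
      funext j
      by_cases hx : x ∈ Set.Icc (0 : Fin d → ℝ) 1
      · simp only [hY, if_pos hx]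
        exact (hω j).limUnder_eq
      · simp only [hY, if_neg hx]
    · filter_upwards [hYosc] with ω hω
      refine continuousOn_pi.2 fun j => ?_
      obtain ⟨n₀, h⟩ := hω j
      exact continuousOn_of_chainWeight (hlam j) hR₀ h
  refine ⟨⟨Y, hYmod⟩, fun Y' hY' => ?_⟩
  have hY'osc : ∀ᵐ ω ∂P, ∀ j, ∃ n₀ : ℕ, ∀ n, n₀ ≤ n → ∀ x ∈ Set.Icc (0 : Fin d → ℝ) 1,
      ∀ y ∈ Set.Icc (0 : Fin d → ℝ) 1, ‖flow E n *ᵥ (x - y)‖ ≤ R₀ →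
        |Y' x ω j - Y' y ω j| ≤ c j * chainWeight (lam j) (p j) n := by
    filter_upwards [hYosc, hYmod.ae_eqOn hY'] with ω hω heq j
    obtain ⟨n₀, h⟩ := hω j
    refine ⟨n₀, fun n hn x hx y hy hxy => ?_⟩
    rw [← heq x hx, ← heq y hy]
    exact h n hn x hx y hy hxy
  refine ⟨fun j => ?_, fun ε hε => ?_⟩
  · filter_upwards [hY'osc] with ω hω
    obtain ⟨n₀, h⟩ := hω j
    refine (modulusLimsup_le_of_chainWeight hE hN (hlam j) (hp j) (hc j) hrad h).trans
      (ENNReal.ofReal_le_ofReal ?_)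
    have := Finset.single_le_sum (fun j _ => hcnn j) (Finset.mem_univ j)
    linarith
  · filter_upwards [hY'osc] with ω hω
    choose n₀ h using hω
    choose K hK0 hK using fun j =>
      exists_holder_of_chainWeight hE hN (hlam j) (hc j) hR₀ hrad (h j) hε
    have hKs : 0 ≤ ∑ j, K j := Finset.sum_nonneg fun j _ => hK0 j
    refine ⟨1 + ∑ j, K j, by positivity, fun j x hx y hy => (hK j x hx y hy).trans ?_⟩
    refine mul_le_mul_of_nonneg_right ?_ (Real.rpow_nonneg (radius_nonneg N _) _)
    have := Finset.single_le_sum (fun j _ => hK0 j) (Finset.mem_univ j)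
    linarith

end Modification

/-! ### Homogeneous kernels -/

section Kernel

variable {𝕜 : Type*} [RCLike 𝕜] {d m : ℕ}

lemma enorm_sq_eq_ofReal (z : 𝕜) : ‖z‖ₑ ^ 2 = ENNReal.ofReal (‖z‖ ^ 2) := by
  rw [ENNReal.ofReal_pow (norm_nonneg _), ofReal_norm]

lemma sum_enorm_sq_mul_le (a : Fin m → ℝ) {α : ℝ} (ha : ∀ i, |a i| ≤ α)
    (q : Matrix (Fin m) (Fin m) 𝕜) :
    ∑ k, ‖∑ i, (a i : 𝕜) * q i k‖ₑ ^ 2 ≤ ENNReal.ofReal (m * α ^ 2) * ∑ i, ∑ k, ‖q i k‖ₑ ^ 2 := by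
  have h : ∀ k, ‖∑ i, (a i : 𝕜) * q i k‖ ^ 2 ≤ (m * α ^ 2) * ∑ i, ‖q i k‖ ^ 2 := by
    intro k
    calc ‖∑ i, (a i : 𝕜) * q i k‖ ^ 2 ≤ (∑ i, |a i| * ‖q i k‖) ^ 2 := by
          gcongr
          refine (norm_sum_le _ _).trans (Finset.sum_le_sum fun i _ => ?_)
          rw [norm_mul, RCLike.norm_ofReal]
      _ ≤ m * ∑ i, (|a i| * ‖q i k‖) ^ 2 := by
          simpa using sq_sum_le_card_mul_sum_sq (s := Finset.univ) (f := fun i => |a i| * ‖q i k‖)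
      _ ≤ m * ∑ i, α ^ 2 * ‖q i k‖ ^ 2 := by
          gcongr with i
          rw [mul_pow]
          gcongr
          exact ha i
      _ = _ := by rw [← Finset.mul_sum, mul_assoc]
  rw [Finset.sum_comm]
  simp only [enorm_sq_eq_ofReal]
  rw [Finset.mul_sum]
  refine Finset.sum_le_sum fun k _ => ?_
  rw [← ENNReal.ofReal_sum_of_nonneg fun _ _ => by positivity, ← ENNReal.ofReal_mul (by positivity)]
  exact ENNReal.ofReal_le_ofReal (h k)

/-- A linear change of variables whose Jacobian is compensated by a factor of the integrand. -/
lemma lintegral_eq_of_comp_mulVec {A : Matrix (Fin d) (Fin d) ℝ} {r : ℝ} (hr : r ^ 2 * A.det = 1)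
    {G H : (Fin d → ℝ) → ℝ≥0∞} (hG : Measurable G)
    (h : ∀ᵐ z, G (A *ᵥ z) = ENNReal.ofReal (r ^ 2) * H z) : ∫⁻ y, G y = ∫⁻ z, H z := by
  have hdet : A.det ≠ 0 := fun h0 => by rw [h0, mul_zero] at hr; exact zero_ne_one hr
  have hr0 : 0 < r ^ 2 := lt_of_le_of_ne (sq_nonneg r) fun h0 => by
    rw [← h0, zero_mul] at hr; exact zero_ne_one hr
  have hdet' : |A.det⁻¹| = r ^ 2 := by
    rw [← eq_inv_of_mul_eq_one_left hr, abs_of_pos hr0]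
  have h1 : ∫⁻ z, G (A *ᵥ z) = ENNReal.ofReal (r ^ 2) * ∫⁻ y, G y := by
    have h2 := lintegral_map (μ := (volume : Measure (Fin d → ℝ))) hG
      (Matrix.toLin' A).continuous_of_finiteDimensional.measurable
    rw [Real.map_matrix_volume_pi_eq_smul_volume_pi hdet, lintegral_smul_measure, hdet'] at h2
    exact h2.symm
  rw [lintegral_congr_ae h, lintegral_const_mul' _ _ ENNReal.ofReal_ne_top] at h1
  exact ((ENNReal.mul_right_inj (ENNReal.ofReal_pos.2 hr0).ne' ENNReal.ofReal_ne_top).1 h1).symm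

/-- The structure that the two kernels have in common: up to isometries of `L²`, the kernel has
stationary increments and is operator self-similar. -/
structure IsScalingKernel (E : Matrix (Fin d) (Fin d) ℝ) (D : Matrix (Fin m) (Fin m) ℝ)
    (Q : (Fin d → ℝ) → (Fin d → ℝ) → Matrix (Fin m) (Fin m) 𝕜) : Prop where
  measurable : ∀ i k, Measurable fun q : (Fin d → ℝ) × (Fin d → ℝ) => Q q.1 q.2 i k
  sub : ∀ x x' j, ∫⁻ y, ∑ k, ‖Q x y j k - Q x' y j k‖ₑ ^ 2 = ∫⁻ y, ∑ k, ‖Q (x - x') y j k‖ₑ ^ 2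
  scale : ∀ s w j, ∫⁻ y, ∑ k, ‖Q (flow E s *ᵥ w) y j k‖ₑ ^ 2 =
    ∫⁻ y, ∑ k, ‖∑ i, (flow D s j i : 𝕜) * Q w y i k‖ₑ ^ 2

namespace IsScalingKernel

variable {E : Matrix (Fin d) (Fin d) ℝ} {D : Matrix (Fin m) (Fin m) ℝ}
  {Q : (Fin d → ℝ) → (Fin d → ℝ) → Matrix (Fin m) (Fin m) 𝕜}

lemma measurable_apply (hQ : IsScalingKernel E D Q) (x : Fin d → ℝ) (i k : Fin m) :
    Measurable fun y => Q x y i k :=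
  (hQ.measurable i k).comp measurable_prodMk_left

lemma row_scale_le (hQ : IsScalingKernel E D Q) {s α : ℝ} {j : Fin m} (h : ∀ i, |flow D s j i| ≤ α)
    (w : Fin d → ℝ) :
    ∫⁻ y, ∑ k, ‖Q (flow E s *ᵥ w) y j k‖ₑ ^ 2 ≤
      ENNReal.ofReal (m * α ^ 2) * ∫⁻ y, ∑ i, ∑ k, ‖Q w y i k‖ₑ ^ 2 := by
  rw [hQ.scale, ← lintegral_const_mul' _ _ ENNReal.ofReal_ne_top]
  exact lintegral_mono fun y => sum_enorm_sq_mul_le _ h _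

lemma lintegral_sum (hQ : IsScalingKernel E D Q) (w : Fin d → ℝ) :
    ∫⁻ y, ∑ i, ∑ k, ‖Q w y i k‖ₑ ^ 2 = ∑ i, ∫⁻ y, ∑ k, ‖Q w y i k‖ₑ ^ 2 :=
  lintegral_finsetSum _ fun i _ => Finset.measurable_fun_sum _ fun k _ =>
    (hQ.measurable_apply w i k).enorm.pow_const 2

lemma sub_le (hQ : IsScalingKernel E D Q) (x x' : Fin d → ℝ) :
    ∫⁻ y, ∑ i, ∑ k, ‖Q (x - x') y i k‖ₑ ^ 2 ≤
      3 * ((∫⁻ y, ∑ i, ∑ k, ‖Q x y i k‖ₑ ^ 2) + ∫⁻ y, ∑ i, ∑ k, ‖Q x' y i k‖ₑ ^ 2) := by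
  rw [hQ.lintegral_sum, hQ.lintegral_sum, hQ.lintegral_sum, ← Finset.sum_add_distrib,
    Finset.mul_sum]
  refine Finset.sum_le_sum fun i _ => ?_
  rw [← hQ.sub, ← lintegral_add_left (Finset.measurable_fun_sum _ fun k _ =>
    (hQ.measurable_apply x i k).enorm.pow_const 2), ← lintegral_const_mul' _ _ (by finiteness)]
  refine lintegral_mono fun y => ?_
  rw [← Finset.sum_add_distrib, Finset.mul_sum]
  refine Finset.sum_le_sum fun k _ => ?_
  have h := enorm_add_add_sq_le (Q x y i k) (-Q x' y i k) 0
  simpa [sub_eq_add_neg] using h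

/-- A kernel that is square integrable for each `w` has norms bounded on bounded sets of `w`. By
Steinhaus' theorem, the differences of the points of a set of positive measure, on which the norm
is bounded, fill a neighbourhood of the origin; the scaling carries the bound to all balls. -/
lemma exists_lintegral_le (hQ : IsScalingKernel E D Q)
    (hE : ∀ μ ∈ spectrum ℂ (E.map Complex.ofReal), 0 < μ.re)
    (hfin : ∀ w, ∫⁻ y, ∑ i, ∑ k, ‖Q w y i k‖ₑ ^ 2 < ∞) (R : ℝ) :
    ∃ K, 0 < K ∧ ∀ w, ‖w‖ ≤ R → ∫⁻ y, ∑ i, ∑ k, ‖Q w y i k‖ₑ ^ 2 ≤ ENNReal.ofReal K := by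
  set I : (Fin d → ℝ) → ℝ≥0∞ := fun w => ∫⁻ y, ∑ i, ∑ k, ‖Q w y i k‖ₑ ^ 2 with hI
  have hImeas : Measurable I := by
    refine Measurable.lintegral_prod_right' (f := fun q : (Fin d → ℝ) × (Fin d → ℝ) =>
      ∑ i, ∑ k, ‖Q q.1 q.2 i k‖ₑ ^ 2) ?_
    exact Finset.measurable_fun_sum _ fun i _ => Finset.measurable_fun_sum _ fun k _ =>
      (hQ.measurable i k).enorm.pow_const 2
  obtain ⟨n, hn⟩ : ∃ n : ℕ, 0 < volume {w | I w ≤ n} := by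
    by_contra! hc
    have hU : (⋃ n : ℕ, {w | I w ≤ n}) = Set.univ := by
      refine Set.eq_univ_of_forall fun w => Set.mem_iUnion.2 ?_
      obtain ⟨n, hn⟩ := ENNReal.exists_nat_gt (hfin w).ne
      exact ⟨n, hn.le⟩
    have h0 : volume (⋃ n : ℕ, {w | I w ≤ n}) = 0 :=
      measure_iUnion_null fun n => le_antisymm (hc n) bot_le
    rw [hU] at h0
    exact (IsOpen.measure_pos volume isOpen_univ Set.univ_nonempty).ne' h0
  have hnhds := Measure.sub_mem_nhds_zero_of_addHaar_pos volume _
    (measurableSet_le hImeas measurable_const) hn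
  obtain ⟨ρ, hρ, hball⟩ := Metric.mem_nhds_iff.1 hnhds
  have hsmall : ∀ w, ‖w‖ < ρ → I w ≤ ENNReal.ofReal (6 * n) := by
    intro w hw
    obtain ⟨x, hx, x', hx', rfl⟩ := Set.mem_sub.1 (hball (mem_ball_zero_iff.2 hw))
    calc I (x - x') ≤ 3 * (I x + I x') := hQ.sub_le x x'
      _ ≤ 3 * ((n : ℝ≥0∞) + n) := by gcongr <;> assumption
      _ = ENNReal.ofReal (6 * n) := by
        rw [ENNReal.ofReal_mul (by norm_num), ENNReal.ofReal_natCast, ENNReal.ofReal_ofNat]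
        ring
  obtain ⟨C, δ, hC, hδ, hdecay⟩ := exists_norm_flow_neg_mulVec_le E hE
  have ht : Tendsto (fun s => C * Real.exp (-(δ * s)) * R) atTop (𝓝 (C * 0 * R)) := by
    refine (Tendsto.const_mul _ ?_).mul_const _
    exact Real.tendsto_exp_neg_atTop_nhds_zero.comp (tendsto_id.const_mul_atTop hδ)
  rw [mul_zero, zero_mul] at ht
  obtain ⟨s, hs1, hs2⟩ := ((ht.eventually_lt_const hρ).and (eventually_ge_atTop 0)).exists
  set α := ∑ j, ∑ i, |flow D s j i| with hα
  have hαle : ∀ j i, |flow D s j i| ≤ α := fun j i =>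
    (Finset.single_le_sum (f := fun i => |flow D s j i|) (fun _ _ => abs_nonneg _)
      (Finset.mem_univ i)).trans (Finset.single_le_sum (f := fun j => ∑ i, |flow D s j i|)
        (fun _ _ => Finset.sum_nonneg fun _ _ => abs_nonneg _) (Finset.mem_univ j))
  refine ⟨m * ((m * α ^ 2) * (6 * n)) + 1, by positivity, fun w hw => ?_⟩
  have hw' : ‖flow E (-s) *ᵥ w‖ < ρ :=
    ((hdecay s hs2 w).trans (by gcongr)).trans_lt hs1
  calc I w = I (flow E s *ᵥ (flow E (-s) *ᵥ w)) := by rw [flow_mulVec_flow_neg]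
    _ ≤ ∑ j : Fin m, ENNReal.ofReal (m * α ^ 2) * I (flow E (-s) *ᵥ w) := by
        rw [hI]
        dsimp only
        rw [hQ.lintegral_sum]
        exact Finset.sum_le_sum fun j _ => hQ.row_scale_le (hαle j) _
    _ ≤ ∑ j : Fin m, ENNReal.ofReal (m * α ^ 2) * ENNReal.ofReal (6 * n) := by
        gcongr; exact hsmall _ hw'
    _ = ENNReal.ofReal (m * ((m * α ^ 2) * (6 * n))) := by
        rw [Finset.sum_const, Finset.card_univ, Fintype.card_fin, nsmul_eq_mul,
          ← ENNReal.ofReal_mul (by positivity), ENNReal.ofReal_mul (p := (m : ℝ)) (by positivity),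
          ENNReal.ofReal_natCast]
    _ ≤ _ := ENNReal.ofReal_le_ofReal (by linarith)

/-- The variance of the increments of the `j`-th coordinate on the scale `e ^ (-n)`. -/
lemma exists_lintegral_sub_lt (hQ : IsScalingKernel E D Q)
    (hE : ∀ μ ∈ spectrum ℂ (E.map Complex.ofReal), 0 < μ.re)
    (hfin : ∀ w, ∫⁻ y, ∑ i, ∑ k, ‖Q w y i k‖ₑ ^ 2 < ∞) {lam : Fin m → ℝ} {p : Fin m → ℕ} {C : ℝ}
    (hC : 0 < C) (hD : ∀ s : ℝ, ∀ i j, |flow D s i j| ≤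
      C * (Real.exp (s * lam i) * (1 + |s|) ^ (p i - 1))) (R : ℝ) :
    ∃ B, 0 < B ∧ ∀ (j : Fin m) (n : ℕ) (u v : Fin d → ℝ), ‖flow E n *ᵥ (u - v)‖ ≤ R →
      ∫⁻ y, ∑ k, ‖Q u y j k - Q v y j k‖ₑ ^ 2 <
        ENNReal.ofReal (B * (Real.exp (-(lam j * n)) * ((n : ℝ) + 1) ^ (p j - 1)) ^ 2) := by
  obtain ⟨K, hK, hKle⟩ := hQ.exists_lintegral_le hE hfin R
  refine ⟨m * C ^ 2 * K + 1, by positivity, fun j n u v huv => ?_⟩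
  set g := Real.exp (-(lam j * n)) * ((n : ℝ) + 1) ^ (p j - 1) with hg
  have hg0 : 0 < g := by positivity
  have h1 : ∀ i, |flow D (-n) j i| ≤ C * g := by
    intro i
    have := hD (-n) j i
    rw [abs_neg, Nat.abs_cast, neg_mul, mul_comm (n : ℝ), add_comm (1 : ℝ)] at this
    exact this
  rw [hQ.sub]
  calc ∫⁻ y, ∑ k, ‖Q (u - v) y j k‖ₑ ^ 2
      = ∫⁻ y, ∑ k, ‖Q (flow E (-n) *ᵥ (flow E n *ᵥ (u - v))) y j k‖ₑ ^ 2 := by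
        rw [flow_neg_mulVec_flow]
    _ ≤ ENNReal.ofReal (m * (C * g) ^ 2) * ENNReal.ofReal K :=
        (hQ.row_scale_le h1 _).trans (by gcongr; exact hKle _ huv)
    _ = ENNReal.ofReal (m * C ^ 2 * K * g ^ 2) := by
        rw [← ENNReal.ofReal_mul (by positivity)]; congr 1; ring
    _ < _ := by
        rw [ENNReal.ofReal_lt_ofReal_iff (by positivity)]
        have : 0 < g ^ 2 := by positivity
        nlinarith

end IsScalingKernel

lemma measurable_matPow_apply {A : Matrix (Fin m) (Fin m) ℝ} (i k : Fin m) :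
    Measurable fun c : ℝ => matPow c A i k := by
  have h : Continuous fun s => flow A s i k := (continuous_flow A).matrix_elem i k
  exact h.measurable.comp Real.measurable_log

lemma matPow_exp_mul {A : Matrix (Fin m) (Fin m) ℝ} (s : ℝ) {c : ℝ} (hc : 0 < c) :
    matPow (Real.exp s * c) A = flow A s * matPow c A := by
  rw [matPow_eq_flow, Real.log_mul (Real.exp_pos s).ne' hc.ne', Real.log_exp, flow_add,
    matPow_eq_flow]

lemma flow_sub_smul_one (A : Matrix (Fin m) (Fin m) ℝ) (c s : ℝ) :
    flow (A - c • 1) s = Real.exp (-(s * c)) • flow A s := by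
  rw [sub_eq_add_neg, ← neg_smul, flow_add_smul_one, mul_neg]

lemma sum_enorm_sq_smul (r : ℝ) (z : Fin m → 𝕜) :
    ∑ k, ‖(r : 𝕜) * z k‖ₑ ^ 2 = ENNReal.ofReal (r ^ 2) * ∑ k, ‖z k‖ₑ ^ 2 := by
  rw [Finset.mul_sum]
  refine Finset.sum_congr rfl fun k _ => ?_
  rw [enorm_sq_eq_ofReal, enorm_sq_eq_ofReal, norm_mul, RCLike.norm_ofReal, mul_pow, sq_abs,
    ENNReal.ofReal_mul (sq_nonneg r)]

/-- An admissible function is continuous away from the origin, since `τ_E(x)` tends to `0`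
with `x`. -/
lemma IsAdmissible.measurable {E : Matrix (Fin d) (Fin d) ℝ} {N : Seminorm ℝ (Fin d → ℝ)} {β : ℝ}
    {φ : (Fin d → ℝ) → ℝ} (hE : ∀ μ ∈ spectrum ℂ (E.map Complex.ofReal), 0 < μ.re)
    (hN : ∀ x, N x = 0 → x = 0) (hβ : 0 < β) (hφ : IsAdmissible E N β φ) : Measurable φ := by
  refine measurable_of_continuousOn_compl_singleton 0 fun y hy => ContinuousAt.continuousWithinAt ?_
  have hNy : 0 < N y := lt_of_le_of_ne (apply_nonneg _ _) fun h => hy (hN y h.symm)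
  obtain ⟨C, hC, h⟩ := hφ.2.2 (N y) (N y + 1) hNy (by linarith)
  rw [Metric.continuousAt_iff]
  intro ε hε
  have ht : Tendsto (fun s => C * Real.exp (-(β * s))) atTop (𝓝 (C * 0)) :=
    (Real.tendsto_exp_neg_atTop_nhds_zero.comp (tendsto_id.const_mul_atTop hβ)).const_mul _
  rw [mul_zero] at ht
  obtain ⟨s, hs1, hs2⟩ := ((ht.eventually_lt_const hε).and (eventually_ge_atTop 0)).exists
  obtain ⟨r, hr, hrad⟩ := exists_radius_le_exp N hE hN (-s)
  refine ⟨r, hr, fun {z} hz => ?_⟩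
  rw [dist_eq_norm] at hz
  have h1 := hrad (z - y) hz.le
  have h2 := h y le_rfl (by linarith) (z - y) (h1.trans (Real.exp_le_one_iff.2 (by linarith)))
  rw [sub_add_cancel] at h2
  rw [Real.dist_eq]
  refine (h2.trans ?_).trans_lt hs1
  gcongr
  calc radius E N (z - y) ^ β ≤ Real.exp (-s) ^ β :=
        Real.rpow_le_rpow (radius_nonneg N _) h1 hβ.le
    _ = Real.exp (-(β * s)) := by rw [← Real.exp_mul]; congr 1; ring

/-- The increments of the moving average kernel are stationary by translation, and the substitution
`y = e ^ (s E) z` scales it. The identities hold off the null set `{0, w}`, where `φ` may vanish; in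
dimension `0` this set is not null. -/
lemma isScalingKernel_movingAverage (hd : 0 < d) {E : Matrix (Fin d) (Fin d) ℝ}
    (D : Matrix (Fin m) (Fin m) ℝ) {φ : (Fin d → ℝ) → ℝ} (hmeas : Measurable φ)
    (hpos : ∀ x, x ≠ 0 → 0 < φ x) (hhom : IsHomogeneous E φ) :
    IsScalingKernel E D (movingAverageKernel E D φ) := by
  have hQ : ∀ i k, Measurable fun q : (Fin d → ℝ) × (Fin d → ℝ) =>
      movingAverageKernel E D φ q.1 q.2 i k := fun i k => by
    simp only [movingAverageKernel, Matrix.sub_apply]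
    exact ((measurable_matPow_apply i k).comp (hmeas.comp (measurable_fst.sub measurable_snd))).sub
      ((measurable_matPow_apply i k).comp (hmeas.comp measurable_snd.neg))
  refine ⟨hQ, fun x x' j => ?_, fun s w j => ?_⟩
  · rw [← lintegral_sub_right_eq_self
      (fun y => ∑ k, ‖movingAverageKernel E D φ (x - x') y j k‖ₑ ^ 2) x']
    refine lintegral_congr fun y => Finset.sum_congr rfl fun k _ => ?_
    simp only [movingAverageKernel, Matrix.sub_apply]
    rw [sub_sub_sub_cancel_right, neg_sub, sub_sub_sub_cancel_right]
  · have hr : Real.exp (-(s * (E.trace / 2))) ^ 2 * (flow E s).det = 1 := by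
      rw [det_flow, ← Real.exp_nat_mul, ← Real.exp_add, Real.exp_eq_one_iff]
      push_cast; ring
    refine lintegral_eq_of_comp_mulVec hr (Finset.measurable_fun_sum _ fun k _ =>
      ((hQ j k).comp measurable_prodMk_left).enorm.pow_const 2) ?_
    have : Nonempty (Fin d) := ⟨⟨0, hd⟩⟩
    have h0 : ∀ᵐ z : Fin d → ℝ, z ≠ 0 ∧ z ≠ w := by
      have h1 : ∀ a : Fin d → ℝ, ∀ᵐ z : Fin d → ℝ, z ≠ a := fun a => by
        simp [ae_iff]
      exact (h1 0).and (h1 w)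
    filter_upwards [h0] with z hz
    have hφ1 : φ (flow E s *ᵥ w - flow E s *ᵥ z) = Real.exp s * φ (w - z) := by
      rw [← Matrix.mulVec_sub, ← matPow_exp]
      exact hhom _ (Real.exp_pos s) _ (sub_ne_zero.2 hz.2.symm)
    have hφ2 : φ (-(flow E s *ᵥ z)) = Real.exp s * φ (-z) := by
      rw [← Matrix.mulVec_neg, ← matPow_exp]
      exact hhom _ (Real.exp_pos s) _ (neg_ne_zero.2 hz.1)
    have hker : movingAverageKernel E D φ (flow E s *ᵥ w) (flow E s *ᵥ z) =
        Real.exp (-(s * (E.trace / 2))) • (flow D s * movingAverageKernel E D φ w z) := by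
      rw [movingAverageKernel, hφ1, hφ2, matPow_exp_mul s (hpos _ (sub_ne_zero.2 hz.2.symm)),
        matPow_exp_mul s (hpos _ (neg_ne_zero.2 hz.1)), ← mul_sub, flow_sub_smul_one,
        smul_mul_assoc, movingAverageKernel]
    rw [← sum_enorm_sq_smul]
    refine Finset.sum_congr rfl fun k _ => ?_
    rw [hker, Matrix.smul_apply, Matrix.mul_apply]
    rfl

lemma norm_exp_sub_exp (a b : ℝ) :
    ‖Complex.exp (Complex.I * (a : ℂ)) - Complex.exp (Complex.I * (b : ℂ))‖ =
      ‖Complex.exp (Complex.I * ((a - b : ℝ) : ℂ)) - 1‖ := by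
  have h : Complex.exp (Complex.I * (a : ℂ)) - Complex.exp (Complex.I * (b : ℂ)) =
      Complex.exp (Complex.I * (b : ℂ)) * (Complex.exp (Complex.I * ((a - b : ℝ) : ℂ)) - 1) := by
    rw [mul_sub, ← Complex.exp_add, mul_one]
    congr 2
    push_cast; ring
  rw [h, norm_mul, mul_comm Complex.I, Complex.norm_exp_ofReal_mul_I, one_mul]

/-- The increments of the harmonizable kernel are stationary because the factors `e ^ (i ⟨x, y⟩)`
have modulus one, and the substitution `y = e ^ (-s Eᵀ) z` scales it. -/
lemma isScalingKernel_harmonizable (hd : 0 < d) {E : Matrix (Fin d) (Fin d) ℝ}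
    (D : Matrix (Fin m) (Fin m) ℝ) {ψ : (Fin d → ℝ) → ℝ} (hmeas : Measurable ψ)
    (hpos : ∀ x, x ≠ 0 → 0 < ψ x) (hhom : IsHomogeneous Eᵀ ψ) :
    IsScalingKernel E D (harmonizableKernel E D ψ) := by
  have hQ : ∀ i k, Measurable fun q : (Fin d → ℝ) × (Fin d → ℝ) =>
      harmonizableKernel E D ψ q.1 q.2 i k := fun i k => by
    simp only [harmonizableKernel, Matrix.smul_apply, Matrix.map_apply, smul_eq_mul]
    have h1 : Measurable fun q : (Fin d → ℝ) × (Fin d → ℝ) => q.1 ⬝ᵥ q.2 := by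
      simp only [dotProduct]
      fun_prop
    have h2 : Measurable fun q : (Fin d → ℝ) × (Fin d → ℝ) =>
        matPow (ψ q.2) (-D - (E.trace / 2) • 1) i k :=
      (measurable_matPow_apply i k).comp (hmeas.comp measurable_snd)
    exact (((Complex.measurable_ofReal.comp h1).const_mul _).cexp.sub_const _).mul
      (Complex.measurable_ofReal.comp h2)
  refine ⟨hQ, fun x x' j => ?_, fun s w j => ?_⟩
  · refine lintegral_congr fun y => Finset.sum_congr rfl fun k _ => ?_
    simp only [harmonizableKernel, Matrix.smul_apply, smul_eq_mul]
    rw [← sub_mul, sub_sub_sub_cancel_right, enorm_sq_eq_ofReal, enorm_sq_eq_ofReal, norm_mul,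
      norm_mul, norm_exp_sub_exp, ← sub_dotProduct]
  · have hr : Real.exp (s * (E.trace / 2)) ^ 2 * (flow Eᵀ (-s)).det = 1 := by
      rw [det_flow, ← Real.exp_nat_mul, ← Real.exp_add, Real.exp_eq_one_iff, Matrix.trace_transpose]
      push_cast; ring
    refine lintegral_eq_of_comp_mulVec hr (Finset.measurable_fun_sum _ fun k _ =>
      ((hQ j k).comp measurable_prodMk_left).enorm.pow_const 2) ?_
    have : Nonempty (Fin d) := ⟨⟨0, hd⟩⟩
    have h0 : ∀ᵐ z : Fin d → ℝ, z ≠ 0 := by simp [ae_iff]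
    filter_upwards [h0] with z hz
    have hψ : ψ (flow Eᵀ (-s) *ᵥ z) = Real.exp (-s) * ψ z := by
      rw [← matPow_exp]
      exact hhom _ (Real.exp_pos _) _ hz
    have hdot : (flow E s *ᵥ w) ⬝ᵥ (flow Eᵀ (-s) *ᵥ z) = w ⬝ᵥ z := by
      rw [flow_transpose, Matrix.mulVec_transpose, dotProduct_comm, ← Matrix.dotProduct_mulVec,
        flow_neg_mulVec_flow, dotProduct_comm]
    have hpow : matPow (ψ (flow Eᵀ (-s) *ᵥ z)) (-D - (E.trace / 2) • 1) =
        Real.exp (s * (E.trace / 2)) • (flow D s * matPow (ψ z) (-D - (E.trace / 2) • 1)) := by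
      rw [hψ, matPow_exp_mul _ (hpos z hz), flow_sub_smul_one, flow_neg_left, neg_neg, neg_mul,
        neg_neg, smul_mul_assoc]
    rw [← sum_enorm_sq_smul]
    refine Finset.sum_congr rfl fun k _ => ?_
    congr 2
    rw [harmonizableKernel, hdot, hpow]
    simp only [harmonizableKernel, Matrix.smul_apply, Matrix.map_apply, Matrix.mul_apply,
      smul_eq_mul, Complex.ofReal_mul, Complex.ofReal_sum, Finset.mul_sum]
    refine Finset.sum_congr rfl fun i _ => ?_
    simp only [Complex.coe_algebraMap]
    ring

end Kernel

/-! ### The modulus of continuity of the fields -/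

section Field

variable {d m : ℕ} {E : Matrix (Fin d) (Fin d) ℝ} {N : Seminorm ℝ (Fin d → ℝ)}
  {D : Matrix (Fin m) (Fin m) ℝ} {lam : Fin m → ℝ} {p : Fin m → ℕ}

/-- A scaling kernel produces the modulus of continuity, with a constant that depends only on the
kernel: the variances of the increments are controlled along the scales `e⁻ⁿ`, so that the
Gaussian tails feed the chaining argument. -/
theorem IsScalingKernel.exists_hasModulusOfContinuity {𝕜 : Type*} [RCLike 𝕜]
    {Q : (Fin d → ℝ) → (Fin d → ℝ) → Matrix (Fin m) (Fin m) 𝕜} (hQ : IsScalingKernel E D Q)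
    (hE : ∀ μ ∈ spectrum ℂ (E.map Complex.ofReal), 0 < μ.re) (hN : ∀ x, N x = 0 → x = 0)
    (hlam : ∀ j, 0 < lam j) (hp : ∀ j, 1 ≤ p j) {C₀ : ℝ} (hC₀ : 0 < C₀)
    (hD : ∀ s : ℝ, ∀ i j, |flow D s i j| ≤
      C₀ * (Real.exp (s * lam i) * (1 + |s|) ^ (p i - 1))) :
    ∃ C, 0 < C ∧ ∀ (Ω : Type*) [MeasurableSpace Ω] (P : Measure Ω) [IsProbabilityMeasure P]
      (X : (Fin d → ℝ) → Ω → (Fin m → ℝ)) (M : Set (Fin d → ℝ) → Ω → (Fin m → 𝕜)),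
      IsGaussianRandomMeasure P M → (∀ x, ∃ Z : Ω → (Fin m → 𝕜), IsStochasticIntegral P M (Q x) Z ∧
        ∀ᵐ ω ∂P, ∀ j, X x ω j = RCLike.re (Z ω j)) →
      HasModulusOfContinuity P (radius E N) lam p C X := by
  -- the square integrability of the kernel is implied by the existence of the field
  by_cases hfin : ∀ w, ∫⁻ y, ∑ i, ∑ k, ‖Q w y i k‖ₑ ^ 2 < ∞
  swap
  · refine ⟨1, one_pos, fun Ω _ P _ X M hM hX => absurd (fun w => ?_) hfin⟩
    obtain ⟨Z, hZ, -⟩ := hX w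
    exact hZ.lintegral_lt_top
  obtain ⟨R, hR, hmod⟩ := OSS.exists_hasModulusOfContinuity (N := N) hE hN hlam hp
  obtain ⟨B, hB, hvar⟩ := hQ.exists_lintegral_sub_lt hE hfin hC₀ hD R
  obtain ⟨C, hC, hmod⟩ := hmod (12 * B) (by positivity)
  refine ⟨C, hC, fun Ω _ P _ X M hM hX => hmod Ω P X fun j n u v huv a ha => ?_⟩
  obtain ⟨Z, hZ, hXZ⟩ := hX u
  obtain ⟨Z', hZ', hXZ'⟩ := hX v
  have h := measure_le_abs_stochasticIntegral_sub_le hM hZ hZ' (hQ.measurable_apply u)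
    (hQ.measurable_apply v) j (hvar j n u v huv) ha
  rw [mul_assoc]
  refine (measure_mono_ae ?_).trans h
  filter_upwards [hXZ, hXZ'] with ω h1 h2 (h3 : a ≤ |X u ω j - X v ω j|)
  rwa [h1 j, h2 j] at h3

/-- The parameter space `ℝ^0` is a single point, and there are no increments to estimate. -/
lemma exists_hasModulusOfContinuity_of_dim_zero (hd : d = 0)
    (hE : ∀ μ ∈ spectrum ℂ (E.map Complex.ofReal), 0 < μ.re) (hN : ∀ x, N x = 0 → x = 0)
    (hlam : ∀ j, 0 < lam j) (hp : ∀ j, 1 ≤ p j) :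
    ∃ C, 0 < C ∧ ∀ (Ω : Type*) [MeasurableSpace Ω] (P : Measure Ω) [IsProbabilityMeasure P]
      (X : (Fin d → ℝ) → Ω → (Fin m → ℝ)), HasModulusOfContinuity P (radius E N) lam p C X := by
  subst hd
  obtain ⟨R, hR, hmod⟩ := exists_hasModulusOfContinuity (N := N) hE hN hlam hp
  obtain ⟨C, hC, hmod⟩ := hmod 1 one_pos
  refine ⟨C, hC, fun Ω _ P _ X => hmod Ω P X fun j n u v huv a ha => ?_⟩
  rw [Subsingleton.elim u v]
  rcases ha.eq_or_lt with rfl | ha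
  · refine prob_le_one.trans ?_
    simp
  · have h : {ω | a ≤ |X v ω j - X v ω j|} = ∅ := by
      ext ω
      simpa using ha
    rw [h, measure_empty]
    exact bot_le

end Field

end OSS

end

theorem mainTheorem2 {d m : ℕ} (D : Matrix (Fin m) (Fin m) ℝ) (lam : Fin m → ℝ)
    (hD : OSS.IsRealCanonicalForm D lam) (hlam : ∀ j, 0 < lam j ∧ lam j < 1) :
    ∃ p : Fin m → ℕ, (∀ j, 1 ≤ p j ∧ p j ≤ m) ∧
      ∀ (E : Matrix (Fin d) (Fin d) ℝ),
        (∀ μ ∈ spectrum ℂ (E.map Complex.ofReal), 1 < μ.re) →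
      ∀ (N : Seminorm ℝ (Fin d → ℝ)), (∀ x, N x = 0 → x = 0) →
        (∀ (β : ℝ) (φ : (Fin d → ℝ) → ℝ), 0 < β → OSS.IsHomogeneous E φ →
          OSS.IsAdmissible E N β φ → (∀ j, lam j < β) → E.trace / 2 ∉ spectrum ℝ D →
          ∃ C : ℝ, 0 < C ∧
            ∀ (Ω : Type*) [MeasurableSpace Ω] (P : Measure Ω) [IsProbabilityMeasure P]
              (X : (Fin d → ℝ) → Ω → (Fin m → ℝ)), OSS.IsMovingAverage P E D φ X →
              OSS.HasModulusOfContinuity P (OSS.radius E N) lam p C X) ∧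
        (∀ ψ : (Fin d → ℝ) → ℝ, (∀ x, 0 ≤ ψ x) → Continuous ψ → (∀ x, x ≠ 0 → ψ x ≠ 0) →
          OSS.IsHomogeneous Eᵀ ψ →
          ∃ C : ℝ, 0 < C ∧
            ∀ (Ω : Type*) [MeasurableSpace Ω] (P : Measure Ω) [IsProbabilityMeasure P]
              (X : (Fin d → ℝ) → Ω → (Fin m → ℝ)), OSS.IsHarmonizable P E D ψ X →
              OSS.HasModulusOfContinuity P (OSS.radius E N) lam p C X) := by
  obtain ⟨p, hp, C₀, hC₀, hflow⟩ := hD.exists_abs_flow_le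
  have hlam' : ∀ j, 0 < lam j := fun j => (hlam j).1
  have hp' : ∀ j, 1 ≤ p j := fun j => (hp j).1
  refine ⟨p, hp, fun E hE N hN => ?_⟩
  have hE' : ∀ μ ∈ spectrum ℂ (E.map Complex.ofReal), 0 < μ.re := fun μ hμ =>
    zero_lt_one.trans (hE μ hμ)
  rcases Nat.eq_zero_or_pos d with hd | hd
  · obtain ⟨C, hC, h⟩ := OSS.exists_hasModulusOfContinuity_of_dim_zero hd hE' hN hlam' hp'
    obtain ⟨C', hC', h'⟩ := OSS.exists_hasModulusOfContinuity_of_dim_zero hd hE' hN hlam' hp'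
    exact ⟨fun _ _ _ _ _ _ _ => ⟨C, hC, fun Ω _ P _ X _ => h Ω P X⟩,
      fun _ _ _ _ _ => ⟨C', hC', fun Ω _ P _ X _ => h' Ω P X⟩⟩
  refine ⟨fun β φ hβ hhom hφ _ _ => ?_, fun ψ hψ0 hψc hψ hhom => ?_⟩
  · have hQ := OSS.isScalingKernel_movingAverage hd D (hφ.measurable hE' hN hβ) hφ.2.1 hhom
    obtain ⟨C, hC, h⟩ := hQ.exists_hasModulusOfContinuity hE' hN hlam' hp' hC₀ hflow
    refine ⟨C, hC, fun Ω _ P _ X hX => ?_⟩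
    obtain ⟨M, hM, hint⟩ := hX
    exact h Ω P X M hM fun x => ⟨X x, hint x, Eventually.of_forall fun ω j => rfl⟩
  · have hQ := OSS.isScalingKernel_harmonizable hd D hψc.measurable
      (fun x hx => lt_of_le_of_ne (hψ0 x) (hψ x hx).symm) hhom
    obtain ⟨C, hC, h⟩ := hQ.exists_hasModulusOfContinuity hE' hN hlam' hp' hC₀ hflow
    refine ⟨C, hC, fun Ω _ P _ X hX => ?_⟩
    obtain ⟨W, hW, hint⟩ := hX
    exact h Ω P X W hW hint
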